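/- Let $M$ be a compact smooth manifold (without boundary), let $T>0$, $I=[0,T]$, and let $g(t)$, $t\in I$, be a smooth Ricci flow on $M$, i.e. a family of Riemannian metrics on $M$, smooth on $M\times I$, with $\partial g/\partial t=-2\,\mathrm{Ric}_{g}$, where $\mathrm{Ric}_g$ is the Ricci tensor of $g(t)$. Let $\nabla^g$ be the Levi-Civita connection of $g(t)$. Let $\hat g=g(t)\oplus dt^2$ on $M\times I$, let $\nabla$ be its Levi-Civita connection and $\widehat{Rm}$ its Riemann curvature tensor, with the convention $\widehat{Rm}(A,B,C,D)=\langle R(A,B)D,C\rangle$, $R(A,B)=\nabla_A\nabla_B-\nabla_B\nabla_A-\nabla_{[A,B]}$. All inner products are taken with respect to $\hat g$, and tangent vectors of $M$ are regarded as horizontal tangent vectors of $M\times I$. Let $c\colon S^1\times I\to M$ be a smooth map such that every $c(\cdot,t)$ is an immersed curve. Put $X=c_*(\partial_x)$, $S=X/|X|$, $H=\nabla^g_SS$ and $k^2=\langle H,H\rangle$, and suppose that $c$ solves the curve-shrinking equation $\partial c/\partial t=H$. Let $\hat c(x,t)=(c(x,t),t)$ and $\widehat H=\hat c_*(\partial_t)=H+\partial_t$.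 Denote by $'$ the derivative with respect to arc length $s$ along $c(\cdot,t)$, i.e. $f'=|X|^{-1}\partial f/\partial x$, and by $(\nabla_SH)^\perp$ the component of $\nabla_SH$ that is $\hat g$-orthogonal to $X$. Then at every point of $S^1\times I$ (with the one-sided time derivative at $t=0$ and $t=T$) $$\begin{aligned} \frac{\partial}{\partial t}k^2={}&(k^2)''-2\bigl\langle(\nabla_SH)^\perp,(\nabla_SH)^\perp\bigr\rangle+2k^4-2\,\mathrm{Ric}_g(H,H)+4k^2\,\mathrm{Ric}_g(S,S)\\ &+2\,\widehat{Rm}(\widehat H,S,H,S)+2\,\mathrm{Ric}_g(S,S)\,\mathrm{Ric}_g(H,H)-2\,(\nabla^g_S\mathrm{Ric}_g)(S,H). \end{aligned}$$ -/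

import Mathlib

open Set
open scoped Manifold ContDiff

set_option maxSynthPendingDepth 3

noncomputable section

namespace RicciCurveFlow

/-! ### Riemannian geometry on a region of a manifold

`N` is a manifold with model `I`, `D ⊆ N` a region (such as `M × [0,T] ⊆ M × ℝ`, or `univ`), and
`g` a field of bilinear forms on the tangent spaces, which is a Riemannian metric on `D`.
All derivatives are taken within `D`, so they are one-sided at a boundary of `D`.

The tangent space `TangentSpace I p` is by definition the model space `E`, identified through the
differential at `p` of the preferred chart `extChartAt I p`.  Tensors at `p` are computed in that
chart, and vectors at `p` are their own coordinate vectors there. -/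

/-! #### Coordinate formulas on a region `U` of the model space -/

section Coordinates

variable {E : Type*} [NormedAddCommGroup E] [NormedSpace ℝ E]

/-- The Christoffel symbols of the first kind
`(u, v) ↦ (w ↦ (∂_u G(v,w) + ∂_v G(u,w) - ∂_w G(u,v)) / 2)` of the metric coefficients `G`. -/
def christoffelFirst (G : E → E →L[ℝ] E →L[ℝ] ℝ) (U : Set E) (y : E) :
    E →L[ℝ] E →L[ℝ] E →L[ℝ] ℝ :=
  let dG : E →L[ℝ] E →L[ℝ] E →L[ℝ] ℝ := fderivWithin ℝ G U y
  let flip : (E →L[ℝ] E →L[ℝ] ℝ) →L[ℝ] E →L[ℝ] E →L[ℝ] ℝ :=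
    (ContinuousLinearMap.flipₗᵢ ℝ E E ℝ).toContinuousLinearEquiv.toContinuousLinearMap
  -- the maps `(u, v, w) ↦ ∂_v G(u,w)` and `(u, v, w) ↦ ∂_w G(u,v)`
  let dG₂ : E →L[ℝ] E →L[ℝ] E →L[ℝ] ℝ := dG.flip
  let dG₃ : E →L[ℝ] E →L[ℝ] E →L[ℝ] ℝ := flip ∘L dG₂
  (1 / 2 : ℝ) • (dG + dG₂ - dG₃)

/-- The Christoffel symbols `Γ(y)(u, v) = Γ^k_{ij} u^i v^j` of the metric coefficients `G`: the
last index of the symbols of the first kind is raised by the inverse of `G(y) : E → E*`. -/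
def christoffel (G : E → E →L[ℝ] E →L[ℝ] ℝ) (U : Set E) (y : E) : E →L[ℝ] E →L[ℝ] E :=
  (ContinuousLinearMap.compL ℝ E (E →L[ℝ] ℝ) E (G y).inverse) ∘L christoffelFirst G U y

/-- The curvature operator `R(u,v)w = ∇_u ∇_v w - ∇_v ∇_u w` (for constant coordinate vectors
`u, v, w`) of the metric coefficients `G`, as a linear map of `u`. -/
def curvature (G : E → E →L[ℝ] E →L[ℝ] ℝ) (U : Set E) (y v w : E) : E →ₗ[ℝ] E :=
  let Γ : E →L[ℝ] E →L[ℝ] E := christoffel G U y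
  let dΓ : E →L[ℝ] E →L[ℝ] E →L[ℝ] E := fderivWithin ℝ (christoffel G U) U y
  { toFun := fun u => dΓ u v w - dΓ v u w + Γ u (Γ v w) - Γ v (Γ u w)
    map_add' := fun a b => by
      simp only [map_add, add_apply]
      abel
    map_smul' := fun r a => by
      simp only [map_smul, smul_apply, RingHom.id_apply, smul_sub, smul_add] }

end Coordinates

section General

variable {E : Type*} [NormedAddCommGroup E] [NormedSpace ℝ E]
  {H : Type*} [TopologicalSpace H] (I : ModelWithCorners ℝ E H)
  {N : Type*} [TopologicalSpace N] [ChartedSpace H N]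

/-- The region `D` read in the preferred chart at `p`. -/
def chartRegion (D : Set N) (p : N) : Set E :=
  (extChartAt I p).target ∩ (extChartAt I p).symm ⁻¹' D

/-- The differential of the inverse of the preferred chart at `p`: it sends a coordinate vector at
the coordinate point `y` to the tangent vector that it represents. -/
def fromChart (p : N) (y : E) : E →L[ℝ] TangentSpace I ((extChartAt I p).symm y) :=
  mfderivWithin 𝓘(ℝ, E) I (extChartAt I p).symm (range I) y

/-- The differential of the preferred chart at `p`: it sends a tangent vector at `q` to its
coordinate vector. -/
def toChart (p q : N) : TangentSpace I q →L[ℝ] E :=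
  mfderiv I 𝓘(ℝ, E) (extChartAt I p) q

/-- The metric read in the preferred chart at `p`: `(u, v) ↦ g(A u, A v)`, where `A` is the
differential of the inverse of the chart; i.e. the coefficients `g_{ij}(y)`. -/
def coordMetric (g : (q : N) → TangentSpace I q →L[ℝ] TangentSpace I q →L[ℝ] ℝ) (p : N) (y : E) :
    E →L[ℝ] E →L[ℝ] ℝ :=
  ContinuousLinearMap.precomp ℝ (fromChart I p y) ∘L
    (g ((extChartAt I p).symm y) ∘L fromChart I p y)

/-- The Christoffel symbols of the Levi-Civita connection of `g` at the point `p`, in the preferred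
chart at `p`. -/
def christoffelAt (g : (q : N) → TangentSpace I q →L[ℝ] TangentSpace I q →L[ℝ] ℝ)
    (D : Set N) (p : N) : E →L[ℝ] E →L[ℝ] E :=
  christoffel (coordMetric I g p) (chartRegion I D p) (extChartAt I p p)

/-- The curvature operator `R(u,v)w = ∇_u ∇_v w - ∇_v ∇_u w - ∇_{[u,v]} w` of `g` at the point
`p`, as a linear map of `u`. -/
def curvatureOp (g : (q : N) → TangentSpace I q →L[ℝ] TangentSpace I q →L[ℝ] ℝ)
    (D : Set N) (p : N) (v w : TangentSpace I p) : TangentSpace I p →ₗ[ℝ] TangentSpace I p :=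
  curvature (E := E) (coordMetric I g p) (chartRegion I D p) (extChartAt I p p) v w

/-- The Riemann curvature tensor, with the convention `Rm(a,b,c,d) = ⟨R(a,b)d, c⟩`; thus
`Rm(a,b,a,b)` is the sectional curvature when `a, b` are orthonormal. -/
def riemann (g : (q : N) → TangentSpace I q →L[ℝ] TangentSpace I q →L[ℝ] ℝ)
    (D : Set N) (p : N) (a b c d : TangentSpace I p) : ℝ :=
  g p (curvatureOp I g D p b d a) c

/-- The Ricci tensor `Ric(v,w) = tr (u ↦ R(u,v)w)`. -/
def ricci (g : (q : N) → TangentSpace I q →L[ℝ] TangentSpace I q →L[ℝ] ℝ)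
    (D : Set N) (p : N) (v w : TangentSpace I p) : ℝ :=
  LinearMap.trace ℝ (TangentSpace I p) (curvatureOp I g D p v w)

/-- The covariant derivative `(∇_a B)(v,w)` at `p` of a field `B` of bilinear forms. -/
def covDerivTensor (g : (q : N) → TangentSpace I q →L[ℝ] TangentSpace I q →L[ℝ] ℝ)
    (D : Set N) (B : (q : N) → TangentSpace I q → TangentSpace I q → ℝ)
    (p : N) (a v w : TangentSpace I p) : ℝ :=
  let y : E := extChartAt I p p
  let Γ : E →L[ℝ] E →L[ℝ] E := christoffelAt I g D p
  fderivWithin ℝ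
      (fun z : E => B ((extChartAt I p).symm z) (fromChart I p z v) (fromChart I p z w))
      (chartRegion I D p) y a
    - B p (Γ a v) w - B p v (Γ a w)

/-- The velocity of a curve in `N`. -/
def velocity (γ : ℝ → N) (x : ℝ) : TangentSpace I (γ x) :=
  mfderiv 𝓘(ℝ, ℝ) I γ x (1 : ℝ)

/-- The covariant derivative `D V / dx` at `x` of a vector field `V` along the curve `γ`. -/
def covDerivAlong (g : (q : N) → TangentSpace I q →L[ℝ] TangentSpace I q →L[ℝ] ℝ)
    (D : Set N) (γ : ℝ → N) (V : (x : ℝ) → TangentSpace I (γ x)) (x : ℝ) :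
    TangentSpace I (γ x) :=
  let Γ : E →L[ℝ] E →L[ℝ] E := christoffelAt I g D (γ x)
  let dV : E := deriv (fun x' => toChart I (γ x) (γ x') (V x')) x
  dV + Γ (velocity I γ x) (V x)

end General

/-! ### Ricci flow and curve shrinking flow -/

variable {n : ℕ} {M : Type*} [TopologicalSpace M] [ChartedSpace (EuclideanSpace ℝ (Fin n)) M]
  [IsManifold (𝓡 n) ∞ M]

/-- A family of smooth Riemannian metrics on `M`, one for each time. Only the times in the interval
under consideration matter. -/
abbrev MetricFamily (n : ℕ) (M : Type*) [TopologicalSpace M]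
    [ChartedSpace (EuclideanSpace ℝ (Fin n)) M] [IsManifold (𝓡 n) ∞ M] : Type _ :=
  ℝ → Bundle.ContMDiffRiemannianMetric (𝓡 n) ∞ (EuclideanSpace ℝ (Fin n))
    (TangentSpace (𝓡 n) : M → Type _)

/-- The Ricci tensor of the metric `g(t)`. -/
def Ric (g : MetricFamily n M) (t : ℝ) (p : M) (v w : TangentSpace (𝓡 n) p) : ℝ :=
  ricci (𝓡 n) (g t).inner univ p v w

/-- `(∇^g_a Ric_g)(v,w)` for the metric `g(t)`. -/
def covDerivRic (g : MetricFamily n M) (t : ℝ) (p : M) (a v w : TangentSpace (𝓡 n) p) : ℝ :=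
  covDerivTensor (𝓡 n) (g t).inner univ (Ric g t) p a v w

/-- A smooth Ricci flow `∂g/∂t = -2 Ric` on `M × [0,T]`. -/
structure IsRicciFlow (g : MetricFamily n M) (T : ℝ) : Prop where
  smooth : ContMDiffOn ((𝓡 n).prod 𝓘(ℝ, ℝ))
    ((𝓡 n).prod 𝓘(ℝ, EuclideanSpace ℝ (Fin n) →L[ℝ] EuclideanSpace ℝ (Fin n) →L[ℝ] ℝ)) ∞
    (fun q : M × ℝ => Bundle.TotalSpace.mk'
      (EuclideanSpace ℝ (Fin n) →L[ℝ] EuclideanSpace ℝ (Fin n) →L[ℝ] ℝ)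
      (E := fun p : M => TangentSpace (𝓡 n) p →L[ℝ] TangentSpace (𝓡 n) p →L[ℝ] ℝ)
      q.1 ((g q.2).inner q.1))
    (univ ×ˢ Icc 0 T)
  evolution : ∀ t ∈ Icc 0 T, ∀ (p : M) (v w : TangentSpace (𝓡 n) p),
    HasDerivWithinAt (fun s => (g s).inner p v w) (-2 * Ric g t p v w) (Icc 0 T) t

/-- The closed curve `c(·,t)`, parametrised by the angle `x ∈ ℝ` on the circle. -/
def curveAt (c : Circle → ℝ → M) (t x : ℝ) : M := c (Circle.exp x) t

/-- `X = c_*(∂_x)`. -/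
def tangentX (c : Circle → ℝ → M) (x t : ℝ) : TangentSpace (𝓡 n) (curveAt c t x) :=
  velocity (𝓡 n) (curveAt c t) x

/-- The speed `|X|`, measured by `g(t)`. -/
def speed (g : MetricFamily n M) (c : Circle → ℝ → M) (x t : ℝ) : ℝ :=
  Real.sqrt ((g t).inner (curveAt c t x) (tangentX c x t) (tangentX c x t))

/-- The unit tangent vector `S = X / |X|`. -/
def unitS (g : MetricFamily n M) (c : Circle → ℝ → M) (x t : ℝ) :
    TangentSpace (𝓡 n) (curveAt c t x) :=
  (speed g c x t)⁻¹ • tangentX c x t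

/-- The curvature vector `H = ∇^g_S S = |X|⁻¹ ∇^g_{∂_x} S`. -/
def vecH (g : MetricFamily n M) (c : Circle → ℝ → M) (x t : ℝ) :
    TangentSpace (𝓡 n) (curveAt c t x) :=
  (speed g c x t)⁻¹ •
    covDerivAlong (𝓡 n) (g t).inner univ (curveAt c t) (fun x' => unitS g c x' t) x

/-- `k² = ⟨H, H⟩`. -/
def kSq (g : MetricFamily n M) (c : Circle → ℝ → M) (x t : ℝ) : ℝ :=
  (g t).inner (curveAt c t x) (vecH g c x t) (vecH g c x t)

/-- The derivative `f' = |X|⁻¹ ∂f/∂x` with respect to arc length along `c(·,t)`. -/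
def arcDeriv (g : MetricFamily n M) (c : Circle → ℝ → M) (t : ℝ) (f : ℝ → ℝ) (x : ℝ) : ℝ :=
  (speed g c x t)⁻¹ * deriv f x

/-- A smooth family of immersed closed curves on `[0,T]` with `∂c/∂t = H`. -/
structure IsCurveShrinkingFlow (g : MetricFamily n M) (T : ℝ) (c : Circle → ℝ → M) : Prop where
  smooth : ContMDiffOn ((𝓡 1).prod 𝓘(ℝ, ℝ)) (𝓡 n) ∞ (fun q : Circle × ℝ => c q.1 q.2)
    (univ ×ˢ Icc 0 T)
  immersed : ∀ x, ∀ t ∈ Icc 0 T, tangentX (n := n) c x t ≠ 0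
  evolution : ∀ x, ∀ t ∈ Icc 0 T,
    mfderivWithin 𝓘(ℝ, ℝ) (𝓡 n) (fun s => curveAt c s x) (Icc 0 T) t (1 : ℝ) = vecH g c x t

/-! ### The product metric on `M × [0,T]`

`M × [0,T]` is treated as a region of the manifold `M × ℝ`. -/

/-- The space-time region `M × [0,T]`. -/
def spaceTime (M : Type*) (T : ℝ) : Set (M × ℝ) := univ ×ˢ Icc 0 T

/-- The tangent vector of `M × ℝ` at `(p,t)` with horizontal component `v` and vertical component
`a ∂_t`. -/
def stVec {p : M} {t : ℝ} (v : TangentSpace (𝓡 n) p) (a : ℝ) :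
    TangentSpace ((𝓡 n).prod 𝓘(ℝ, ℝ)) (p, t) :=
  ((v, a) : EuclideanSpace ℝ (Fin n) × ℝ)

/-- The metric `ĝ = g(t) ⊕ dt²`. -/
def gHat (g : MetricFamily n M) (q : M × ℝ) :
    TangentSpace ((𝓡 n).prod 𝓘(ℝ, ℝ)) q →L[ℝ] TangentSpace ((𝓡 n).prod 𝓘(ℝ, ℝ)) q →L[ℝ] ℝ :=
  let horizontal : EuclideanSpace ℝ (Fin n) × ℝ →L[ℝ] TangentSpace (𝓡 n) q.1 :=
    ContinuousLinearMap.fst ℝ (EuclideanSpace ℝ (Fin n)) ℝ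
  let vertical : EuclideanSpace ℝ (Fin n) × ℝ →L[ℝ] ℝ :=
    ContinuousLinearMap.snd ℝ (EuclideanSpace ℝ (Fin n)) ℝ
  (ContinuousLinearMap.precomp ℝ horizontal ∘L ((g q.2).inner q.1 ∘L horizontal) +
    ContinuousLinearMap.precomp ℝ vertical ∘L (ContinuousLinearMap.mul ℝ ℝ ∘L vertical) :
    EuclideanSpace ℝ (Fin n) × ℝ →L[ℝ] EuclideanSpace ℝ (Fin n) × ℝ →L[ℝ] ℝ)

/-- The Riemann curvature tensor of `ĝ` on `M × [0,T]`. -/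
def rmHat (g : MetricFamily n M) (T : ℝ) (q : M × ℝ)
    (v₁ v₂ v₃ v₄ : TangentSpace ((𝓡 n).prod 𝓘(ℝ, ℝ)) q) : ℝ :=
  riemann ((𝓡 n).prod 𝓘(ℝ, ℝ)) (gHat g) (spaceTime M T) q v₁ v₂ v₃ v₄

/-- `ĉ(x,t) = (c(x,t), t)`. -/
def cHat (c : Circle → ℝ → M) (t x : ℝ) : M × ℝ := (curveAt c t x, t)

/-- `Ĥ = ĉ_*(∂_t)`. -/
def hHat (T : ℝ) (c : Circle → ℝ → M) (x t : ℝ) :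
    TangentSpace ((𝓡 n).prod 𝓘(ℝ, ℝ)) (cHat c t x) :=
  mfderivWithin 𝓘(ℝ, ℝ) ((𝓡 n).prod 𝓘(ℝ, ℝ)) (fun s => cHat c s x) (Icc 0 T) t (1 : ℝ)

/-- `X` as a horizontal vector of `M × [0,T]` along `ĉ`. -/
def xHor (c : Circle → ℝ → M) (x t : ℝ) : TangentSpace ((𝓡 n).prod 𝓘(ℝ, ℝ)) (cHat c t x) :=
  stVec (tangentX c x t) 0

/-- `S` as a horizontal vector of `M × [0,T]` along `ĉ`. -/
def sHor (g : MetricFamily n M) (c : Circle → ℝ → M) (x t : ℝ) :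
    TangentSpace ((𝓡 n).prod 𝓘(ℝ, ℝ)) (cHat c t x) :=
  stVec (unitS g c x t) 0

/-- `H` as a horizontal vector of `M × [0,T]` along `ĉ`. -/
def hHor (g : MetricFamily n M) (c : Circle → ℝ → M) (x t : ℝ) :
    TangentSpace ((𝓡 n).prod 𝓘(ℝ, ℝ)) (cHat c t x) :=
  stVec (vecH g c x t) 0

/-- `∇_S H = |X|⁻¹ ∇_{∂_x} H`, where `∇` is the Levi-Civita connection of `ĝ`. -/
def nablaSH (g : MetricFamily n M) (T : ℝ) (c : Circle → ℝ → M) (x t : ℝ) :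
    TangentSpace ((𝓡 n).prod 𝓘(ℝ, ℝ)) (cHat c t x) :=
  (speed g c x t)⁻¹ •
    covDerivAlong ((𝓡 n).prod 𝓘(ℝ, ℝ)) (gHat g) (spaceTime M T) (cHat c t)
      (fun x' => hHor g c x' t) x

/-- `(∇_S H)^⊥`, the component of `∇_S H` that is `ĝ`-orthogonal to `X`. -/
def nablaSHPerp (g : MetricFamily n M) (T : ℝ) (c : Circle → ℝ → M) (x t : ℝ) :
    TangentSpace ((𝓡 n).prod 𝓘(ℝ, ℝ)) (cHat c t x) :=
  nablaSH g T c x t -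
    (gHat g (cHat c t x) (nablaSH g T c x t) (xHor c x t) /
      gHat g (cHat c t x) (xHor c x t) (xHor c x t)) • xHor c x t

end RicciCurveFlow

end

open RicciCurveFlow

noncomputable section

namespace RicciCurveFlow

/-! ### Levi-Civita calculus in coordinates, for fields along a map. -/

section Coordinates

variable {F : Type*} [NormedAddCommGroup F] [NormedSpace ℝ F]
  {G : F → F →L[ℝ] F →L[ℝ] ℝ} {U : Set F}

/-! The equation is the commutator identity for second covariant derivatives of S along the
space-time map ĉ, paired with H. Put h = -½ ∂g/∂t. In ĝ = g ⊕ dt² the second fundamental form of a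
time slice with respect to ∂_t is h, and ⟨∇_V ∂_t, W⟩ = -h(V, W) on horizontal parts. With σ = |X|
and r = h(S,S) this gives ∇_S S = H + r ∂_t (`covST_x_S`). Since ĉ_x = σS and ĉ_t = H + ∂_t,
vanishing torsion gives ∇_t(σS) = ∇_x(H + ∂_t) (`covST_t_X`). Its S-component is the evolution of
the speed, ∂_t σ = -σ(k² + r) (`fderivWithin_σ`), and therefore ∇_t S = ∇_S H + ∇_S ∂_t + (k² + r) S
(`covST_t_S`).

Substitute both formulas into ∇_t∇_x S - ∇_x∇_t S = R(Ĥ, X)S and take the product with H. The S- and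
∂_t-components vanish. The term ⟨∇_x∇_S H, H⟩ yields (k²)'' and -2|∇_S H|². The term ⟨∇_x∇_S ∂_t, H⟩
yields -(∇_S h)(S,H) - h(H,H) (`metric_covST_nablaVert`). From r⟨∇_t ∂_t, H⟩ = -r h(H,H) comes the
product of the two Ricci terms. Finally ⟨∇_S H, S⟩ = -k², so |∇_S H|² = |(∇_S H)^⊥|² + k⁴. The
result in coordinates is `fderivWithin_curvSq_t`; it holds for any smooth family of metrics, with h
in place of Ric.

The rest is translation. Near a given point the flow is read in the single chart centred there
(`isCoordFlow_chart`). This needs chart independence of the covariant derivative along a curve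
(`toChart_covDerivAlong`), because the curvature vector at each nearby point is defined in that
point's own chart. The Ricci flow equation turns h into Ric (`Ric_fromChart`). -/

theorem christoffelFirst_apply (G : F → F →L[ℝ] F →L[ℝ] ℝ) (U : Set F) (y u v w : F) :
    christoffelFirst G U y u v w = (1 / 2 : ℝ) * (fderivWithin ℝ G U y u v w
      + fderivWithin ℝ G U y v u w - fderivWithin ℝ G U y w u v) := by
  rfl

theorem christoffel_apply (G : F → F →L[ℝ] F →L[ℝ] ℝ) (U : Set F) (y u v : F) :
    christoffel G U y u v = (G y).inverse (christoffelFirst G U y u v) := by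
  rfl

/-- The coefficients `G` of a smooth pseudo-Riemannian metric on a region `U` of the model space. -/
structure IsMetricOn (G : F → F →L[ℝ] F →L[ℝ] ℝ) (U : Set F) : Prop where
  smooth : ContDiffOn ℝ ∞ G U
  symm : ∀ y ∈ U, ∀ v w, G y v w = G y w v
  invertible : ∀ y ∈ U, (G y).IsInvertible
  uniqueDiffOn : UniqueDiffOn ℝ U

namespace IsMetricOn

theorem differentiableOn (hG : IsMetricOn G U) : DifferentiableOn ℝ G U :=
  hG.smooth.differentiableOn (by simp)

theorem fderivWithin_apply (hG : IsMetricOn G U) {y : F} (hy : y ∈ U) (a b c : F) :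
    fderivWithin ℝ (fun z => G z b c) U y a = fderivWithin ℝ G U y a b c := by
  have h := (hG.differentiableOn y hy).hasFDerivWithinAt
  have h' := (h.clm_apply (hasFDerivWithinAt_const b y U)).clm_apply
    (hasFDerivWithinAt_const c y U)
  rw [h'.fderivWithin (hG.uniqueDiffOn y hy)]
  simp

theorem fderivWithin_symm (hG : IsMetricOn G U) {y : F} (hy : y ∈ U) (a b c : F) :
    fderivWithin ℝ G U y a b c = fderivWithin ℝ G U y a c b := by
  rw [← hG.fderivWithin_apply hy, ← hG.fderivWithin_apply hy]
  congr 1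
  exact fderivWithin_congr (fun z hz => hG.symm z hz b c) (hG.symm y hy b c)

theorem metric_christoffel (hG : IsMetricOn G U) {y : F} (hy : y ∈ U) (a b c : F) :
    G y (christoffel G U y a b) c = christoffelFirst G U y a b c := by
  rw [christoffel_apply, (hG.invertible y hy).self_apply_inverse]

theorem christoffel_symm (hG : IsMetricOn G U) {y : F} (hy : y ∈ U) (a b : F) :
    christoffel G U y a b = christoffel G U y b a := by
  rw [christoffel_apply, christoffel_apply]
  congr 1
  ext c
  rw [christoffelFirst_apply, christoffelFirst_apply, hG.fderivWithin_symm hy c a b]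
  ring

/-- The pointwise form of metric compatibility: `IsMetricOn.fderivWithin_metric` reduces to it after
the product rule. -/
theorem christoffelFirst_add (hG : IsMetricOn G U) {y : F} (hy : y ∈ U) (a b c : F) :
    christoffelFirst G U y a b c + christoffelFirst G U y a c b = fderivWithin ℝ G U y a b c := by
  rw [christoffelFirst_apply, christoffelFirst_apply,
    hG.fderivWithin_symm hy a c b]
  ring

/-- Two vectors with the same products with all vectors are equal. -/
theorem ext_metric (hG : IsMetricOn G U) {y : F} (hy : y ∈ U) {a b : F}
    (h : ∀ c, G y a c = G y b c) : a = b :=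
  (hG.invertible y hy).injective (ContinuousLinearMap.ext h)

theorem contDiffOn_fderivWithin (hG : IsMetricOn G U) :
    ContDiffOn ℝ ∞ (fderivWithin ℝ G U) U :=
  hG.smooth.fderivWithin hG.uniqueDiffOn (by simp)

variable [FiniteDimensional ℝ F]

theorem contDiffOn_christoffelFirst (hG : IsMetricOn G U) :
    ContDiffOn ℝ ∞ (christoffelFirst G U) U := by
  have h := hG.contDiffOn_fderivWithin
  have key : ∀ a b c : F, ContDiffOn ℝ ∞ (fun y => fderivWithin ℝ G U y a b c) U := fun a b c =>
    ((h.clm_apply contDiffOn_const).clm_apply contDiffOn_const).clm_apply contDiffOn_const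
  refine contDiffOn_clm_apply.2 fun a => contDiffOn_clm_apply.2 fun b =>
    contDiffOn_clm_apply.2 fun c => ?_
  simp only [christoffelFirst_apply]
  exact contDiffOn_const.mul (((key a b c).add (key b a c)).sub (key c a b))

theorem contDiffOn_christoffel (hG : IsMetricOn G U) :
    ContDiffOn ℝ ∞ (christoffel G U) U := by
  have : CompleteSpace F := FiniteDimensional.complete ℝ F
  -- Operator inversion is smooth at every invertible operator of a complete space.
  have hinv : ContDiffOn ℝ ∞ (fun y => (G y).inverse) U := by
    intro y hy
    obtain ⟨e, he⟩ := hG.invertible y hy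
    have h := contDiffAt_map_inverse (n := ∞) e
    rw [he] at h
    exact h.comp_contDiffWithinAt y (hG.smooth y hy)
  refine contDiffOn_clm_apply.2 fun a => contDiffOn_clm_apply.2 fun b => ?_
  simp only [christoffel_apply]
  exact hinv.clm_apply ((hG.contDiffOn_christoffelFirst.clm_apply contDiffOn_const).clm_apply
    contDiffOn_const)

end IsMetricOn

/-! #### Vector fields along a map into the region -/

variable {P : Type*} [NormedAddCommGroup P] [NormedSpace ℝ P]

/-- The covariant derivative in the direction `d` of a vector field `V` along a map
`u : P → F` that is defined on `s`. -/
def covDerivMap (G : F → F →L[ℝ] F →L[ℝ] ℝ) (U : Set F) (s : Set P) (u : P → F) (d : P)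
    (V : P → F) (z : P) : F :=
  fderivWithin ℝ V s z d + christoffel G U (u z) (fderivWithin ℝ u s z d) (V z)

variable {s : Set P} {u V W : P → F} {z : P}

theorem covDerivMap_smul (hs : UniqueDiffOn ℝ s) (hz : z ∈ s) {f : P → ℝ}
    (hf : DifferentiableWithinAt ℝ f s z) (hV : DifferentiableWithinAt ℝ V s z) (d : P) :
    covDerivMap G U s u d (fun z => f z • V z) z
      = fderivWithin ℝ f s z d • V z + f z • covDerivMap G U s u d V z := by
  have h := (hf.hasFDerivWithinAt.smul hV.hasFDerivWithinAt).fderivWithin (hs z hz)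
  simp only [covDerivMap]
  erw [h]
  simp only [add_apply, smul_apply, ContinuousLinearMap.smulRight_apply, map_smul, smul_add]
  abel

theorem covDerivMap_add (hs : UniqueDiffOn ℝ s) (hz : z ∈ s)
    (hV : DifferentiableWithinAt ℝ V s z) (hW : DifferentiableWithinAt ℝ W s z) (d : P) :
    covDerivMap G U s u d (fun z => V z + W z) z
      = covDerivMap G U s u d V z + covDerivMap G U s u d W z := by
  simp only [covDerivMap, fderivWithin_fun_add (hs z hz) hV hW, add_apply, map_add]
  abel

theorem covDerivMap_congr (hz : z ∈ s) (h : EqOn V W s) (d : P) :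
    covDerivMap G U s u d V z = covDerivMap G U s u d W z := by
  simp only [covDerivMap, fderivWithin_congr h (h hz), h hz]

/-- The Levi-Civita connection is compatible with the metric. -/
theorem IsMetricOn.fderivWithin_metric (hG : IsMetricOn G U) (hs : UniqueDiffOn ℝ s)
    (hu : DifferentiableOn ℝ u s) (hmaps : MapsTo u s U) (hz : z ∈ s)
    (hV : DifferentiableWithinAt ℝ V s z) (hW : DifferentiableWithinAt ℝ W s z) (d : P) :
    fderivWithin ℝ (fun z => G (u z) (V z) (W z)) s z d
      = G (u z) (covDerivMap G U s u d V z) (W z)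
        + G (u z) (V z) (covDerivMap G U s u d W z) := by
  have hy := hmaps hz
  have hGu : HasFDerivWithinAt (fun z => G (u z)) _ s z :=
    (hG.differentiableOn _ hy).hasFDerivWithinAt.comp z (hu z hz).hasFDerivWithinAt hmaps
  have h := ((hGu.clm_apply hV.hasFDerivWithinAt).clm_apply hW.hasFDerivWithinAt)
  rw [h.fderivWithin (hs z hz)]
  simp only [covDerivMap, map_add, add_apply, ContinuousLinearMap.comp_apply,
    ContinuousLinearMap.flip_apply]
  rw [hG.metric_christoffel hy, hG.symm _ hy (V z) (christoffel _ _ _ _ _),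
    hG.metric_christoffel hy, ← hG.christoffelFirst_add hy]
  ring

/-- Second derivatives within `s` commute. -/
theorem fderivWithin_fderivWithin_comm (hs : UniqueDiffOn ℝ s) (hcl : s ⊆ closure (interior s))
    (hu : ContDiffOn ℝ ∞ u s) (hz : z ∈ s) (d e : P) :
    fderivWithin ℝ (fun z => fderivWithin ℝ u s z e) s z d
      = fderivWithin ℝ (fun z => fderivWithin ℝ u s z d) s z e := by
  -- At boundary points, here the times 0 and T, symmetry is inherited as a limit from the interior
  -- of `s`; this is the role of `hcl`.
  have h2 : IsSymmSndFDerivWithinAt ℝ u s z :=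
    (hu z hz).isSymmSndFDerivWithinAt (by
      rw [minSmoothness_of_isRCLikeNormedField]
      exact WithTop.coe_le_coe.2 (le_top : (2 : ℕ∞) ≤ ⊤)) hs (hcl hz) hz
  have hd : DifferentiableWithinAt ℝ (fderivWithin ℝ u s) s z :=
    (hu.fderivWithin hs (m := ∞) (by simp)).differentiableOn (by simp) z hz
  have key : ∀ a b, fderivWithin ℝ (fun z => fderivWithin ℝ u s z a) s z b
      = fderivWithin ℝ (fderivWithin ℝ u s) s z b a := fun a b => by
    rw [(hd.hasFDerivWithinAt.clm_apply (hasFDerivWithinAt_const a z s)).fderivWithin (hs z hz)]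
    simp
  rw [key, key, h2.eq]

/-- The Levi-Civita connection is torsion free. -/
theorem IsMetricOn.covDerivMap_comm (hG : IsMetricOn G U) (hs : UniqueDiffOn ℝ s)
    (hcl : s ⊆ closure (interior s)) (hu : ContDiffOn ℝ ∞ u s) (hmaps : MapsTo u s U)
    (hz : z ∈ s) (d e : P) :
    covDerivMap G U s u d (fun z => fderivWithin ℝ u s z e) z
      = covDerivMap G U s u e (fun z => fderivWithin ℝ u s z d) z := by
  simp only [covDerivMap]
  rw [fderivWithin_fderivWithin_comm hs hcl hu hz d e, hG.christoffel_symm (hmaps hz)]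

theorem IsMetricOn.contDiffOn_covDerivMap [FiniteDimensional ℝ F] (hG : IsMetricOn G U)
    (hs : UniqueDiffOn ℝ s) (hu : ContDiffOn ℝ ∞ u s) (hmaps : MapsTo u s U)
    (hV : ContDiffOn ℝ ∞ V s) (d : P) :
    ContDiffOn ℝ ∞ (covDerivMap G U s u d V) s := by
  refine ((hV.fderivWithin hs (by simp)).clm_apply contDiffOn_const).add ?_
  exact ((hG.contDiffOn_christoffel.comp hu hmaps).clm_apply
    ((hu.fderivWithin hs (by simp)).clm_apply contDiffOn_const)).clm_apply hV

/-- The commutator of covariant derivatives is the curvature. -/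
theorem IsMetricOn.covDerivMap_covDerivMap_sub [FiniteDimensional ℝ F] (hG : IsMetricOn G U)
    (hs : UniqueDiffOn ℝ s) (hcl : s ⊆ closure (interior s)) (hu : ContDiffOn ℝ ∞ u s)
    (hmaps : MapsTo u s U) (hV : ContDiffOn ℝ ∞ V s) (hz : z ∈ s) (d e : P) :
    covDerivMap G U s u d (covDerivMap G U s u e V) z
        - covDerivMap G U s u e (covDerivMap G U s u d V) z
      = curvature G U (u z) (fderivWithin ℝ u s z e) (V z) (fderivWithin ℝ u s z d) := by
  have key : ∀ d e, fderivWithin ℝ (covDerivMap G U s u e V) s z d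
      = fderivWithin ℝ (fun z => fderivWithin ℝ V s z e) s z d
        + fderivWithin ℝ (christoffel G U) U (u z) (fderivWithin ℝ u s z d)
            (fderivWithin ℝ u s z e) (V z)
        + christoffel G U (u z) (fderivWithin ℝ (fun z => fderivWithin ℝ u s z e) s z d) (V z)
        + christoffel G U (u z) (fderivWithin ℝ u s z e) (fderivWithin ℝ V s z d) := by
    intro d e
    have hΓ : HasFDerivWithinAt (fun z => christoffel G U (u z)) _ s z :=
      (hG.contDiffOn_christoffel.differentiableOn (by simp) _ (hmaps hz)).hasFDerivWithinAt.comp z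
        (hu.differentiableOn (by simp) z hz).hasFDerivWithinAt hmaps
    have hue : DifferentiableWithinAt ℝ (fun z => fderivWithin ℝ u s z e) s z :=
      ((hu.fderivWithin hs (m := ∞) (by simp)).clm_apply contDiffOn_const).differentiableOn
        (by simp) z hz
    have hVe : DifferentiableWithinAt ℝ (fun z => fderivWithin ℝ V s z e) s z :=
      ((hV.fderivWithin hs (m := ∞) (by simp)).clm_apply contDiffOn_const).differentiableOn
        (by simp) z hz
    have hVz := (hV.differentiableOn (by simp) z hz).hasFDerivWithinAt
    have h := hVe.hasFDerivWithinAt.add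
      ((hΓ.clm_apply hue.hasFDerivWithinAt).clm_apply hVz)
    erw [h.fderivWithin (hs z hz)]
    simp only [add_apply, ContinuousLinearMap.comp_apply, ContinuousLinearMap.flip_apply]
    abel
  have hdef : ∀ d W, covDerivMap G U s u d W z = fderivWithin ℝ W s z d
      + christoffel G U (u z) (fderivWithin ℝ u s z d) (W z) := fun _ _ => rfl
  rw [hdef d (covDerivMap _ _ _ _ _ _), hdef e (covDerivMap _ _ _ _ _ _), key, key,
    fderivWithin_fderivWithin_comm hs hcl hV hz d e,
    fderivWithin_fderivWithin_comm hs hcl hu hz d e]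
  simp only [covDerivMap, curvature, LinearMap.coe_mk, AddHom.coe_mk, map_add]
  abel

end Coordinates

/-! ### The Christoffel symbols of G(t) ⊕ dt². -/

section SpaceTime

/-- A positive definite form on a finite-dimensional space is invertible. -/
theorem isInvertible_of_pos {F : Type*} [NormedAddCommGroup F] [NormedSpace ℝ F]
    [FiniteDimensional ℝ F] (B : F →L[ℝ] F →L[ℝ] ℝ) (hB : ∀ v, v ≠ 0 → 0 < B v v) :
    B.IsInvertible := by
  have hinj : Function.Injective (B : F →ₗ[ℝ] F →L[ℝ] ℝ) := by
    refine (injective_iff_map_eq_zero _).2 fun v hv => ?_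
    by_contra hne
    have h := hB v hne
    rw [show B v = 0 from hv] at h
    simp at h
  have hrank : Module.finrank ℝ F = Module.finrank ℝ (F →L[ℝ] ℝ) := by
    rw [← (LinearMap.toContinuousLinearMap (𝕜 := ℝ) (E := F) (F' := ℝ)).finrank_eq]
    exact (Subspace.dual_finrank_eq (K := ℝ) (V := F)).symm
  refine ⟨(LinearMap.linearEquivOfInjective _ hinj hrank).toContinuousLinearEquiv, ?_⟩
  ext v
  rfl

variable {E : Type*} [NormedAddCommGroup E] [NormedSpace ℝ E]

/-- The coefficients of the metric `G(t) ⊕ dt²`. -/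
def stMetric (G : ℝ → E → E →L[ℝ] E →L[ℝ] ℝ) (q : E × ℝ) : E × ℝ →L[ℝ] E × ℝ →L[ℝ] ℝ :=
  ContinuousLinearMap.precomp ℝ (ContinuousLinearMap.fst ℝ E ℝ) ∘L
      (G q.2 q.1 ∘L ContinuousLinearMap.fst ℝ E ℝ) +
    ContinuousLinearMap.precomp ℝ (ContinuousLinearMap.snd ℝ E ℝ) ∘L
      (ContinuousLinearMap.mul ℝ ℝ ∘L ContinuousLinearMap.snd ℝ E ℝ)

theorem stMetric_apply (G : ℝ → E → E →L[ℝ] E →L[ℝ] ℝ) (q v w : E × ℝ) :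
    stMetric G q v w = G q.2 q.1 v.1 w.1 + v.2 * w.2 := by
  rfl

/-- The tensor `-½ ∂G/∂t`. -/
def halfNegTimeDeriv (G : ℝ → E → E →L[ℝ] E →L[ℝ] ℝ) (U : Set E) (J : Set ℝ) (q : E × ℝ) :
    E →L[ℝ] E →L[ℝ] ℝ :=
  (-(1 / 2) : ℝ) • fderivWithin ℝ (fun q : E × ℝ => G q.2 q.1) (U ×ˢ J) q (0, 1)

/-- The coefficients `G(t)`, `t ∈ J`, of a smooth family of Riemannian metrics on an open set. -/
structure IsMetricFamilyOn (G : ℝ → E → E →L[ℝ] E →L[ℝ] ℝ) (U : Set E) (J : Set ℝ) : Prop where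
  smooth : ContDiffOn ℝ ∞ (fun q : E × ℝ => G q.2 q.1) (U ×ˢ J)
  symm : ∀ t ∈ J, ∀ y ∈ U, ∀ v w, G t y v w = G t y w v
  pos : ∀ t ∈ J, ∀ y ∈ U, ∀ v, v ≠ 0 → 0 < G t y v v
  isOpen : IsOpen U
  uniqueDiffOn : UniqueDiffOn ℝ J

namespace IsMetricFamilyOn

variable {G : ℝ → E → E →L[ℝ] E →L[ℝ] ℝ} {U : Set E} {J : Set ℝ}

theorem differentiableOn (hG : IsMetricFamilyOn G U J) :
    DifferentiableOn ℝ (fun q : E × ℝ => G q.2 q.1) (U ×ˢ J) :=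
  hG.smooth.differentiableOn (by simp)

theorem uniqueDiffOn_prod (hG : IsMetricFamilyOn G U J) : UniqueDiffOn ℝ (U ×ˢ J) :=
  hG.isOpen.uniqueDiffOn.prod hG.uniqueDiffOn

theorem fderivWithin_horizontal (hG : IsMetricFamilyOn G U J) {y : E} {t : ℝ} (hy : y ∈ U)
    (ht : t ∈ J) (v : E) :
    fderivWithin ℝ (fun q : E × ℝ => G q.2 q.1) (U ×ˢ J) (y, t) (v, 0)
      = fderivWithin ℝ (G t) U y v := by
  have h1 := (hG.differentiableOn (y, t) ⟨hy, ht⟩).hasFDerivWithinAt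
  have h2 : HasFDerivWithinAt (fun y' : E => (y', t)) (ContinuousLinearMap.inl ℝ E ℝ) U y :=
    (hasFDerivAt_prodMk_left y t).hasFDerivWithinAt
  have h3 := HasFDerivWithinAt.comp (g := fun q : E × ℝ => G q.2 q.1) y h1 h2
    (t := U ×ˢ J) (fun y' hy' => ⟨hy', ht⟩)
  rw [show G t = (fun q : E × ℝ => G q.2 q.1) ∘ fun y' : E => (y', t) from rfl,
    h3.fderivWithin (hG.isOpen.uniqueDiffOn y hy)]
  rfl

theorem contDiffOn_halfNegTimeDeriv (hG : IsMetricFamilyOn G U J) :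
    ContDiffOn ℝ ∞ (halfNegTimeDeriv G U J) (U ×ˢ J) :=
  ((hG.smooth.fderivWithin hG.uniqueDiffOn_prod (by simp)).clm_apply
    contDiffOn_const).const_smul _

variable [FiniteDimensional ℝ E]

theorem isMetricOn (hG : IsMetricFamilyOn G U J) {t : ℝ} (ht : t ∈ J) : IsMetricOn (G t) U where
  smooth := hG.smooth.comp (f := fun y : E => (y, t)) (by fun_prop) fun y hy => ⟨hy, ht⟩
  symm := hG.symm t ht
  invertible y hy := isInvertible_of_pos _ (hG.pos t ht y hy)
  uniqueDiffOn := hG.isOpen.uniqueDiffOn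

theorem isMetricOn_stMetric (hG : IsMetricFamilyOn G U J) :
    IsMetricOn (stMetric G) (U ×ˢ J) where
  smooth := by
    refine contDiffOn_clm_apply.2 fun a => contDiffOn_clm_apply.2 fun b => ?_
    simp only [stMetric_apply]
    exact ((hG.smooth.clm_apply contDiffOn_const).clm_apply contDiffOn_const).add contDiffOn_const
  symm q hq v w := by
    rw [stMetric_apply, stMetric_apply, hG.symm _ hq.2 _ hq.1, mul_comm]
  invertible q hq := by
    refine isInvertible_of_pos _ fun v hv => ?_
    rw [stMetric_apply]
    by_cases h1 : v.1 = 0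
    · have h2 : v.2 ≠ 0 := fun h2 => hv (Prod.ext h1 h2)
      have := mul_self_pos.2 h2
      simpa [h1] using this
    · have := hG.pos _ hq.2 _ hq.1 _ h1
      have := mul_self_nonneg v.2
      linarith
  uniqueDiffOn := hG.uniqueDiffOn_prod

theorem fderivWithin_stMetric (hG : IsMetricFamilyOn G U J) {q : E × ℝ} (hq : q ∈ U ×ˢ J)
    (a b c : E × ℝ) :
    fderivWithin ℝ (stMetric G) (U ×ˢ J) q a b c
      = fderivWithin ℝ (fun q : E × ℝ => G q.2 q.1) (U ×ˢ J) q a b.1 c.1 := by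
  rw [← hG.isMetricOn_stMetric.fderivWithin_apply hq]
  simp only [stMetric_apply]
  have h := (((hG.differentiableOn q hq).hasFDerivWithinAt.clm_apply
    (hasFDerivWithinAt_const b.1 q _)).clm_apply (hasFDerivWithinAt_const c.1 q _)).add_const
      (b.2 * c.2)
  rw [h.fderivWithin (hG.uniqueDiffOn_prod q hq)]
  simp

/-- Horizontal test vectors see only the Christoffel symbols of G(t). The test vector ∂_t sees only
the term of the Koszul formula that differentiates G in time, which enters with a minus sign: this
is the second fundamental form of the time slice. -/
theorem christoffel_stMetric_horizontal (hG : IsMetricFamilyOn G U J) {y : E} {t : ℝ}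
    (hy : y ∈ U) (ht : t ∈ J) (v w : E) :
    christoffel (stMetric G) (U ×ˢ J) (y, t) (v, 0) (w, 0)
      = (christoffel (G t) U y v w, halfNegTimeDeriv G U J (y, t) v w) := by
  have hq : (y, t) ∈ U ×ˢ J := ⟨hy, ht⟩
  refine hG.isMetricOn_stMetric.ext_metric hq fun c => ?_
  have hc : c = (c.1, 0) + c.2 • (0, 1) := by ext <;> simp
  rw [hG.isMetricOn_stMetric.metric_christoffel hq, christoffelFirst_apply,
    hG.fderivWithin_stMetric hq, hG.fderivWithin_stMetric hq, hG.fderivWithin_stMetric hq,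
    stMetric_apply]
  dsimp only
  rw [(hG.isMetricOn ht).metric_christoffel hy, christoffelFirst_apply, hc, map_add, map_smul,
    hG.fderivWithin_horizontal hy ht, hG.fderivWithin_horizontal hy ht,
    hG.fderivWithin_horizontal hy ht]
  simp [halfNegTimeDeriv]
  ring

/-- Derivatives of the space-time metric ignore vertical entries because dt² is constant, so one
Koszul term survives. In particular the lines of constant position are geodesics. -/
theorem stMetric_christoffel_vertical (hG : IsMetricFamilyOn G U J) {q : E × ℝ}
    (hq : q ∈ U ×ˢ J) (v c : E × ℝ) :
    stMetric G q (christoffel (stMetric G) (U ×ˢ J) q v (0, 1)) c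
      = - halfNegTimeDeriv G U J q v.1 c.1 := by
  rw [hG.isMetricOn_stMetric.metric_christoffel hq, christoffelFirst_apply,
    hG.fderivWithin_stMetric hq, hG.fderivWithin_stMetric hq, hG.fderivWithin_stMetric hq]
  simp [halfNegTimeDeriv]

end IsMetricFamilyOn

end SpaceTime

/-! ### The evolution equation in coordinates, with -½ ∂G/∂t in place of Ric. -/

section CoordinateFlow

variable {E : Type*} [NormedAddCommGroup E] [NormedSpace ℝ E]

/-- A curve shrinking flow `u(x,t)` in coordinates, on a region `s` of the `(x,t)`-plane, in the
family of metrics `G(t)`. Here `σ` is the speed, `S` the unit tangent and `H` the curvature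
vector. -/
structure IsCoordFlow (G : ℝ → E → E →L[ℝ] E →L[ℝ] ℝ) (U : Set E) (J : Set ℝ) (s : Set (ℝ × ℝ))
    (u : ℝ × ℝ → E) (σ : ℝ × ℝ → ℝ) (S H : ℝ × ℝ → E) : Prop where
  metric : IsMetricFamilyOn G U J
  uniqueDiffOn : UniqueDiffOn ℝ s
  subset_closure : s ⊆ closure (interior s)
  smooth_u : ContDiffOn ℝ ∞ u s
  smooth_σ : ContDiffOn ℝ ∞ σ s
  smooth_S : ContDiffOn ℝ ∞ S s
  smooth_H : ContDiffOn ℝ ∞ H s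
  mapsTo : ∀ z ∈ s, u z ∈ U
  mem_J : ∀ z ∈ s, z.2 ∈ J
  σ_pos : ∀ z ∈ s, 0 < σ z
  deriv_x : ∀ z ∈ s, fderivWithin ℝ u s z (1, 0) = σ z • S z
  unit : ∀ z ∈ s, G z.2 (u z) (S z) (S z) = 1
  curvature : ∀ z ∈ s, fderivWithin ℝ S s z (1, 0)
    + christoffel (G z.2) U (u z) (fderivWithin ℝ u s z (1, 0)) (S z) = σ z • H z
  evolution : ∀ z ∈ s, fderivWithin ℝ u s z (0, 1) = H z

/-- The lift `(u(x,t), t)` to space-time. -/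
def liftST (u : ℝ × ℝ → E) (z : ℝ × ℝ) : E × ℝ := (u z, z.2)

/-- The space-time covariant derivative along `(u(x,t), t)`. -/
abbrev covST (G : ℝ → E → E →L[ℝ] E →L[ℝ] ℝ) (U : Set E) (J : Set ℝ) (s : Set (ℝ × ℝ))
    (u : ℝ × ℝ → E) (d : ℝ × ℝ) (V : ℝ × ℝ → E × ℝ) (z : ℝ × ℝ) : E × ℝ :=
  covDerivMap (stMetric G) (U ×ˢ J) s (liftST u) d V z

/-- A vector field in `E` as a horizontal vector field of space-time. -/
def hor (V : ℝ × ℝ → E) (z : ℝ × ℝ) : E × ℝ := (V z, 0)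

/-- The vertical field `∂_t`. -/
def vert (E : Type*) [NormedAddCommGroup E] (_ : ℝ × ℝ) : E × ℝ := (0, 1)

namespace IsCoordFlow

variable {G : ℝ → E → E →L[ℝ] E →L[ℝ] ℝ} {U : Set E} {J : Set ℝ} {s : Set (ℝ × ℝ)}
  {u : ℝ × ℝ → E} {σ : ℝ × ℝ → ℝ} {S H : ℝ × ℝ → E} {z : ℝ × ℝ}

theorem contDiffOn_liftST (h : IsCoordFlow G U J s u σ S H) : ContDiffOn ℝ ∞ (liftST u) s :=
  h.smooth_u.prodMk contDiff_snd.contDiffOn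

theorem mapsTo_liftST (h : IsCoordFlow G U J s u σ S H) : MapsTo (liftST u) s (U ×ˢ J) :=
  fun z hz => ⟨h.mapsTo z hz, h.mem_J z hz⟩

theorem contDiffOn_hor {V : ℝ × ℝ → E} (hV : ContDiffOn ℝ ∞ V s) : ContDiffOn ℝ ∞ (hor V) s :=
  hV.prodMk contDiffOn_const

theorem contDiffOn_vert : ContDiffOn ℝ ∞ (vert E) s := contDiffOn_const

theorem fderivWithin_hor (h : IsCoordFlow G U J s u σ S H) {V : ℝ × ℝ → E}
    (hV : ContDiffOn ℝ ∞ V s) (hz : z ∈ s) (d : ℝ × ℝ) :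
    fderivWithin ℝ (hor V) s z d = (fderivWithin ℝ V s z d, 0) := by
  have h1 := (hV.differentiableOn (by simp) z hz).hasFDerivWithinAt.prodMk
    (hasFDerivWithinAt_const (0 : ℝ) z s)
  erw [h1.fderivWithin (h.uniqueDiffOn z hz)]
  rfl

theorem fderivWithin_liftST (h : IsCoordFlow G U J s u σ S H) (hz : z ∈ s) (d : ℝ × ℝ) :
    fderivWithin ℝ (liftST u) s z d = (fderivWithin ℝ u s z d, d.2) := by
  have h1 := (h.smooth_u.differentiableOn (by simp) z hz).hasFDerivWithinAt.prodMk
    (hasFDerivWithinAt_snd (𝕜 := ℝ) (E := ℝ) (F := ℝ) (p := z) (s := s))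
  erw [h1.fderivWithin (h.uniqueDiffOn z hz)]
  rfl

theorem liftST_x (h : IsCoordFlow G U J s u σ S H) (hz : z ∈ s) :
    fderivWithin ℝ (liftST u) s z (1, 0) = σ z • hor S z := by
  rw [h.fderivWithin_liftST hz, h.deriv_x z hz]
  simp [hor]

theorem liftST_t (h : IsCoordFlow G U J s u σ S H) (hz : z ∈ s) :
    fderivWithin ℝ (liftST u) s z (0, 1) = hor H z + vert E z := by
  rw [h.fderivWithin_liftST hz, h.evolution z hz]
  simp [hor, vert]

theorem covST_smul (h : IsCoordFlow G U J s u σ S H) (hz : z ∈ s) {f : ℝ × ℝ → ℝ}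
    {V : ℝ × ℝ → E × ℝ} (hf : ContDiffOn ℝ ∞ f s) (hV : ContDiffOn ℝ ∞ V s) (d : ℝ × ℝ) :
    covST G U J s u d (fun z => f z • V z) z
      = fderivWithin ℝ f s z d • V z + f z • covST G U J s u d V z :=
  covDerivMap_smul h.uniqueDiffOn hz (hf.differentiableOn (by simp) z hz)
    (hV.differentiableOn (by simp) z hz) d

theorem covST_add (h : IsCoordFlow G U J s u σ S H) (hz : z ∈ s)
    {V W : ℝ × ℝ → E × ℝ} (hV : ContDiffOn ℝ ∞ V s) (hW : ContDiffOn ℝ ∞ W s) (d : ℝ × ℝ) :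
    covST G U J s u d (fun z => V z + W z) z
      = covST G U J s u d V z + covST G U J s u d W z :=
  covDerivMap_add h.uniqueDiffOn hz (hV.differentiableOn (by simp) z hz)
    (hW.differentiableOn (by simp) z hz) d

/-- `-½ ∂G/∂t` evaluated on two fields along the flow. -/
abbrev tensorAlong (G : ℝ → E → E →L[ℝ] E →L[ℝ] ℝ) (U : Set E) (J : Set ℝ) (u : ℝ × ℝ → E)
    (V W : ℝ × ℝ → E) (z : ℝ × ℝ) : ℝ :=
  halfNegTimeDeriv G U J (u z, z.2) (V z) (W z)

theorem contDiffOn_tensorAlong (h : IsCoordFlow G U J s u σ S H) {V W : ℝ × ℝ → E}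
    (hV : ContDiffOn ℝ ∞ V s) (hW : ContDiffOn ℝ ∞ W s) :
    ContDiffOn ℝ ∞ (tensorAlong G U J u V W) s :=
  ((h.metric.contDiffOn_halfNegTimeDeriv.comp h.contDiffOn_liftST h.mapsTo_liftST).clm_apply
    hV).clm_apply hW

theorem metric_hor_vert (V : ℝ × ℝ → E) : stMetric G (liftST u z) (hor V z) (vert E z) = 0 := by
  simp [stMetric_apply, hor, vert]

theorem metric_vert_hor (V : ℝ × ℝ → E) : stMetric G (liftST u z) (vert E z) (hor V z) = 0 := by
  simp [stMetric_apply, hor, vert]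

theorem metric_S_S (h : IsCoordFlow G U J s u σ S H) (hz : z ∈ s) :
    stMetric G (liftST u z) (hor S z) (hor S z) = 1 := by
  simpa [stMetric_apply, hor, liftST] using h.unit z hz

/-- The square of the curvature. -/
abbrev curvSq (G : ℝ → E → E →L[ℝ] E →L[ℝ] ℝ) (u H : ℝ × ℝ → E) (z : ℝ × ℝ) : ℝ :=
  stMetric G (liftST u z) (hor H z) (hor H z)

theorem contDiffOn_inv_σ (h : IsCoordFlow G U J s u σ S H) : ContDiffOn ℝ ∞ (fun z => (σ z)⁻¹) s :=
  h.smooth_σ.inv fun z hz => ne_of_gt (h.σ_pos z hz)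

/-- The covariant derivative `(∇_S h)(S, H)` of `h = -½ ∂G/∂t`. -/
abbrev nablaTensor (G : ℝ → E → E →L[ℝ] E →L[ℝ] ℝ) (U : Set E) (J : Set ℝ) (u : ℝ × ℝ → E)
    (S H : ℝ × ℝ → E) (z : ℝ × ℝ) : ℝ :=
  fderivWithin ℝ (fun y => halfNegTimeDeriv G U J (y, z.2) (S z) (H z)) U (u z) (S z)
    - halfNegTimeDeriv G U J (u z, z.2) (christoffel (G z.2) U (u z) (S z) (S z)) (H z)
    - halfNegTimeDeriv G U J (u z, z.2) (S z) (christoffel (G z.2) U (u z) (S z) (H z))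

/-- The x-velocity of the lifted map is horizontal, so the chain rule involves no time derivative of
the tensor. -/
theorem fderivWithin_tensorAlong (h : IsCoordFlow G U J s u σ S H) (hz : z ∈ s) :
    fderivWithin ℝ (tensorAlong G U J u S H) s z (1, 0)
      = σ z * fderivWithin ℝ (fun y => halfNegTimeDeriv G U J (y, z.2) (S z) (H z)) U (u z) (S z)
        + halfNegTimeDeriv G U J (u z, z.2) (fderivWithin ℝ S s z (1, 0)) (H z)
        + halfNegTimeDeriv G U J (u z, z.2) (S z) (fderivWithin ℝ H s z (1, 0)) := by
  have hq := h.mapsTo_liftST hz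
  have h1 := (h.metric.contDiffOn_halfNegTimeDeriv.differentiableOn (by simp) _
    hq).hasFDerivWithinAt
  have h2 := h1.comp z (h.contDiffOn_liftST.differentiableOn (by simp) z hz).hasFDerivWithinAt
    h.mapsTo_liftST
  have h3 := (h2.clm_apply (h.smooth_S.differentiableOn (by simp) z hz).hasFDerivWithinAt).clm_apply
    (h.smooth_H.differentiableOn (by simp) z hz).hasFDerivWithinAt
  have h4 : HasFDerivWithinAt (fun y : E => (y, z.2)) (ContinuousLinearMap.inl ℝ E ℝ) U (u z) :=
    (hasFDerivAt_prodMk_left (u z) z.2).hasFDerivWithinAt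
  have h5 := HasFDerivWithinAt.comp (g := halfNegTimeDeriv G U J) (u z) h1 h4
    (t := U ×ˢ J) (fun y hy => ⟨hy, h.mem_J z hz⟩)
  have h6 := (h5.clm_apply (hasFDerivWithinAt_const (S z) _ _)).clm_apply
    (hasFDerivWithinAt_const (H z) _ _)
  erw [h3.fderivWithin (h.uniqueDiffOn z hz),
    h6.fderivWithin (h.metric.isOpen.uniqueDiffOn _ (h.mapsTo z hz))]
  simp only [add_apply, ContinuousLinearMap.comp_apply, ContinuousLinearMap.flip_apply,
    h.liftST_x hz, zero_apply, map_zero, zero_add, map_smul, smul_apply, smul_eq_mul,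
    Function.comp_apply, ContinuousLinearMap.inl_apply, liftST, hor]
  ring

variable [FiniteDimensional ℝ E]

theorem metricST (h : IsCoordFlow G U J s u σ S H) : IsMetricOn (stMetric G) (U ×ˢ J) :=
  h.metric.isMetricOn_stMetric

theorem fderivWithin_metric (h : IsCoordFlow G U J s u σ S H) (hz : z ∈ s)
    {V W : ℝ × ℝ → E × ℝ} (hV : ContDiffOn ℝ ∞ V s) (hW : ContDiffOn ℝ ∞ W s) (d : ℝ × ℝ) :
    fderivWithin ℝ (fun z => stMetric G (liftST u z) (V z) (W z)) s z d
      = stMetric G (liftST u z) (covST G U J s u d V z) (W z)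
        + stMetric G (liftST u z) (V z) (covST G U J s u d W z) :=
  h.metricST.fderivWithin_metric h.uniqueDiffOn (h.contDiffOn_liftST.differentiableOn (by simp))
    h.mapsTo_liftST hz (hV.differentiableOn (by simp) z hz) (hW.differentiableOn (by simp) z hz) d

theorem contDiffOn_covST (h : IsCoordFlow G U J s u σ S H) {V : ℝ × ℝ → E × ℝ}
    (hV : ContDiffOn ℝ ∞ V s) (d : ℝ × ℝ) : ContDiffOn ℝ ∞ (covST G U J s u d V) s :=
  h.metricST.contDiffOn_covDerivMap h.uniqueDiffOn h.contDiffOn_liftST h.mapsTo_liftST hV d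

theorem covST_hor_x (h : IsCoordFlow G U J s u σ S H) {V : ℝ × ℝ → E} (hV : ContDiffOn ℝ ∞ V s)
    (hz : z ∈ s) :
    covST G U J s u (1, 0) (hor V) z
      = (fderivWithin ℝ V s z (1, 0)
          + christoffel (G z.2) U (u z) (fderivWithin ℝ u s z (1, 0)) (V z),
        σ z * halfNegTimeDeriv G U J (u z, z.2) (S z) (V z)) := by
  rw [covST, covDerivMap, h.fderivWithin_hor hV hz, h.fderivWithin_liftST hz]
  simp only [liftST, hor]
  rw [h.metric.christoffel_stMetric_horizontal (h.mapsTo z hz) (h.mem_J z hz), h.deriv_x z hz]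
  simp

/-- The space-time curvature vector of the curve is H plus the normal curvature of the time slice in
direction S. -/
theorem covST_x_S (h : IsCoordFlow G U J s u σ S H) (hz : z ∈ s) :
    covST G U J s u (1, 0) (hor S) z
      = σ z • (hor H z + tensorAlong G U J u S S z • vert E z) := by
  rw [h.covST_hor_x h.smooth_S hz, h.curvature z hz]
  simp [hor, vert]

/-- The field ∂_t is constant in coordinates, so only its Christoffel term remains. -/
theorem metric_covST_vert (h : IsCoordFlow G U J s u σ S H) (hz : z ∈ s) (d : ℝ × ℝ)
    (c : E × ℝ) :
    stMetric G (liftST u z) (covST G U J s u d (vert E) z) c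
      = - halfNegTimeDeriv G U J (u z, z.2) (fderivWithin ℝ u s z d) c.1 := by
  have h0 : fderivWithin ℝ (vert E) s z = 0 := by
    unfold vert; simp
  rw [covST, covDerivMap, h0, h.fderivWithin_liftST hz, zero_apply, zero_add, vert,
    h.metric.stMetric_christoffel_vertical (h.mapsTo_liftST hz)]
  rfl

theorem metric_comm (h : IsCoordFlow G U J s u σ S H) (hz : z ∈ s) (a b : E × ℝ) :
    stMetric G (liftST u z) a b = stMetric G (liftST u z) b a :=
  h.metricST.symm _ (h.mapsTo_liftST hz) a b

/-- Differentiate ⟨S, S⟩ = 1 along the curve; the ∂_t-part of ∇_x S is orthogonal to S. -/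
theorem metric_H_S (h : IsCoordFlow G U J s u σ S H) (hz : z ∈ s) :
    stMetric G (liftST u z) (hor H z) (hor S z) = 0 := by
  have hS := contDiffOn_hor h.smooth_S
  have h1 := h.fderivWithin_metric hz hS hS (1, 0)
  rw [fderivWithin_congr (fun z hz => h.metric_S_S hz) (h.metric_S_S hz), fderivWithin_const_apply,
    h.metric_comm hz (hor S z), h.covST_x_S hz] at h1
  simp only [map_smul, map_add, smul_apply, add_apply, metric_vert_hor, smul_eq_mul, zero_apply]
    at h1
  have := h.σ_pos z hz
  nlinarith

/-- Differentiate ⟨H, S⟩ = 0 along the curve. -/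
theorem metric_covST_H_S (h : IsCoordFlow G U J s u σ S H) (hz : z ∈ s) :
    stMetric G (liftST u z) (covST G U J s u (1, 0) (hor H) z) (hor S z)
      = - (σ z * curvSq G u H z) := by
  have h1 := h.fderivWithin_metric hz (contDiffOn_hor h.smooth_H) (contDiffOn_hor h.smooth_S) (1, 0)
  rw [fderivWithin_congr (fun z hz => h.metric_H_S hz) (h.metric_H_S hz), fderivWithin_const_apply,
    h.covST_x_S hz] at h1
  simp only [map_smul, map_add, metric_hor_vert, smul_eq_mul, zero_apply] at h1
  linarith

/-- Torsion-freeness for the lifted map, whose partial derivatives are X and H + ∂_t. -/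
theorem covST_t_X (h : IsCoordFlow G U J s u σ S H) (hz : z ∈ s) :
    covST G U J s u (0, 1) (fun z => σ z • hor S z) z
      = covST G U J s u (1, 0) (hor H) z + covST G U J s u (1, 0) (vert E) z := by
  rw [← h.covST_add hz (contDiffOn_hor h.smooth_H) contDiffOn_vert]
  rw [covST, covST, covDerivMap_congr hz (fun z hz => (h.liftST_x hz).symm) (0, 1),
    h.metricST.covDerivMap_comm h.uniqueDiffOn h.subset_closure h.contDiffOn_liftST
      h.mapsTo_liftST hz]
  exact covDerivMap_congr hz (fun z hz => h.liftST_t hz) (1, 0)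

theorem metric_covST_vert_x (h : IsCoordFlow G U J s u σ S H) (hz : z ∈ s) (c : E × ℝ) :
    stMetric G (liftST u z) (covST G U J s u (1, 0) (vert E) z) c
      = - (σ z * halfNegTimeDeriv G U J (u z, z.2) (S z) c.1) := by
  rw [h.metric_covST_vert hz, h.deriv_x z hz]
  simp

/-- The evolution of the speed. -/
theorem fderivWithin_σ (h : IsCoordFlow G U J s u σ S H) (hz : z ∈ s) :
    fderivWithin ℝ σ s z (0, 1)
      = - (σ z * (curvSq G u H z + tensorAlong G U J u S S z)) := by
  have hS := contDiffOn_hor h.smooth_S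
  have h1 := congrArg (fun a => stMetric G (liftST u z) a (hor S z)) (h.covST_t_X hz)
  simp only [h.covST_smul hz h.smooth_σ hS, map_add, map_smul, add_apply, smul_apply, smul_eq_mul,
    h.metric_S_S hz, h.metric_covST_H_S hz, h.metric_covST_vert_x hz] at h1
  -- Because S has unit length, ∇_t S has no S-component, so the left side of `h1` is just ∂_t σ.
  have h2 := h.fderivWithin_metric hz hS hS (0, 1)
  rw [fderivWithin_congr (fun z hz => h.metric_S_S hz) (h.metric_S_S hz), fderivWithin_const_apply,
    h.metric_comm hz (hor S z), zero_apply] at h2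
  have h3 : stMetric G (liftST u z) (covST G U J s u (0, 1) (hor S) z) (hor S z) = 0 := by linarith
  rw [h3] at h1
  simp only [hor] at h1 ⊢
  linarith

/-- `∇_S H`. -/
abbrev nablaH (G : ℝ → E → E →L[ℝ] E →L[ℝ] ℝ) (U : Set E) (J : Set ℝ) (s : Set (ℝ × ℝ))
    (u : ℝ × ℝ → E) (σ : ℝ × ℝ → ℝ) (H : ℝ × ℝ → E) (z : ℝ × ℝ) : E × ℝ :=
  (σ z)⁻¹ • covST G U J s u (1, 0) (hor H) z

theorem metric_nablaH_S (h : IsCoordFlow G U J s u σ S H) (hz : z ∈ s) :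
    stMetric G (liftST u z) (nablaH G U J s u σ H z) (hor S z) = - curvSq G u H z := by
  have hσ := (h.σ_pos z hz).ne'
  rw [nablaH, map_smul, smul_apply, h.metric_covST_H_S hz, smul_eq_mul, mul_neg,
    inv_mul_cancel_left₀ hσ]

/-- `∇_S ∂_t`. -/
abbrev nablaVert (G : ℝ → E → E →L[ℝ] E →L[ℝ] ℝ) (U : Set E) (J : Set ℝ) (s : Set (ℝ × ℝ))
    (u : ℝ × ℝ → E) (σ : ℝ × ℝ → ℝ) (z : ℝ × ℝ) : E × ℝ :=
  (σ z)⁻¹ • covST G U J s u (1, 0) (vert E) z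

theorem covST_t_S (h : IsCoordFlow G U J s u σ S H) (hz : z ∈ s) :
    covST G U J s u (0, 1) (hor S) z = nablaH G U J s u σ H z + nablaVert G U J s u σ z
      + (curvSq G u H z + tensorAlong G U J u S S z) • hor S z := by
  have h1 := h.covST_t_X hz
  rw [h.covST_smul hz h.smooth_σ (contDiffOn_hor h.smooth_S), h.fderivWithin_σ hz] at h1
  have hσ := (h.σ_pos z hz).ne'
  have h2 : σ z • covST G U J s u (0, 1) (hor S) z
      = covST G U J s u (1, 0) (hor H) z + covST G U J s u (1, 0) (vert E) z
        + (σ z * (curvSq G u H z + tensorAlong G U J u S S z)) • hor S z := by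
    rw [← h1, neg_smul]
    abel
  rw [← inv_smul_smul₀ hσ (covST G U J s u (0, 1) (hor S) z), h2, smul_add, smul_add, mul_smul,
    inv_smul_smul₀ hσ]

theorem contDiffOn_nablaH (h : IsCoordFlow G U J s u σ S H) :
    ContDiffOn ℝ ∞ (nablaH G U J s u σ H) s :=
  h.contDiffOn_inv_σ.smul (h.contDiffOn_covST (contDiffOn_hor h.smooth_H) _)

theorem contDiffOn_nablaVert (h : IsCoordFlow G U J s u σ S H) :
    ContDiffOn ℝ ∞ (nablaVert G U J s u σ) s :=
  h.contDiffOn_inv_σ.smul (h.contDiffOn_covST contDiffOn_vert _)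

theorem contDiffOn_metric (h : IsCoordFlow G U J s u σ S H) {V W : ℝ × ℝ → E × ℝ}
    (hV : ContDiffOn ℝ ∞ V s) (hW : ContDiffOn ℝ ∞ W s) :
    ContDiffOn ℝ ∞ (fun z => stMetric G (liftST u z) (V z) (W z)) s :=
  ((h.metricST.smooth.comp h.contDiffOn_liftST h.mapsTo_liftST).clm_apply hV).clm_apply hW

theorem fderivWithin_curvSq_x (h : IsCoordFlow G U J s u σ S H) (hz : z ∈ s) :
    (σ z)⁻¹ * fderivWithin ℝ (curvSq G u H) s z (1, 0)
      = 2 * stMetric G (liftST u z) (nablaH G U J s u σ H z) (hor H z) := by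
  have hH := contDiffOn_hor h.smooth_H
  rw [h.fderivWithin_metric hz hH hH, h.metric_comm hz (hor H z)]
  simp only [nablaH, map_smul, smul_apply, smul_eq_mul]
  ring

/-- The second arc length derivative of `k²`. -/
theorem fderivWithin_fderivWithin_curvSq (h : IsCoordFlow G U J s u σ S H) (hz : z ∈ s) :
    (σ z)⁻¹ * fderivWithin ℝ (fun z => (σ z)⁻¹ * fderivWithin ℝ (curvSq G u H) s z (1, 0))
        s z (1, 0)
      = 2 * ((σ z)⁻¹ * stMetric G (liftST u z)
            (covST G U J s u (1, 0) (nablaH G U J s u σ H) z) (hor H z))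
        + 2 * stMetric G (liftST u z) (nablaH G U J s u σ H z) (nablaH G U J s u σ H z) := by
  have hH := contDiffOn_hor h.smooth_H
  have hd := (h.contDiffOn_metric h.contDiffOn_nablaH hH).differentiableOn (by simp) z hz
  rw [fderivWithin_congr (fun z hz => h.fderivWithin_curvSq_x hz) (h.fderivWithin_curvSq_x hz),
    fderivWithin_const_mul (h.uniqueDiffOn z hz) hd, smul_apply, smul_eq_mul,
    h.fderivWithin_metric hz h.contDiffOn_nablaH hH]
  simp only [nablaH, map_smul, smul_apply, smul_eq_mul]
  ring

/-- Differentiate ⟨∇_S ∂_t, H⟩ = -h(S, H) along the curve, where h = -½ ∂G/∂t. Replacing coordinate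
derivatives of S and H by covariant ones produces ∇h; the term h(H, H) appears because ∇^g_S S = H.
-/
theorem metric_covST_nablaVert (h : IsCoordFlow G U J s u σ S H) (hz : z ∈ s) :
    (σ z)⁻¹ * stMetric G (liftST u z) (covST G U J s u (1, 0) (nablaVert G U J s u σ) z) (hor H z)
      = - nablaTensor G U J u S H z - tensorAlong G U J u H H z := by
  have hQ : ∀ z ∈ s, ∀ c : E × ℝ, stMetric G (liftST u z) (nablaVert G U J s u σ z) c
      = - halfNegTimeDeriv G U J (u z, z.2) (S z) c.1 := by
    intro z hz c
    have hσ := (h.σ_pos z hz).ne'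
    simp only [nablaVert, map_smul, smul_apply, smul_eq_mul, h.metric_covST_vert_x hz]
    field_simp
  have h1 := h.fderivWithin_metric hz h.contDiffOn_nablaVert (contDiffOn_hor h.smooth_H) (1, 0)
  have hE : EqOn (fun z => stMetric G (liftST u z) (nablaVert G U J s u σ z) (hor H z))
      (fun z => - tensorAlong G U J u S H z) s := fun z hz => hQ z hz _
  rw [fderivWithin_congr hE (hE hz), fderivWithin_fun_neg (h.uniqueDiffOn z hz), neg_apply,
    h.fderivWithin_tensorAlong hz, hQ z hz, h.covST_hor_x h.smooth_H hz,
    eq_sub_of_add_eq (h.curvature z hz), h.deriv_x z hz] at h1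
  simp only [map_sub, map_add, map_smul, sub_apply, smul_apply, smul_eq_mul] at h1
  have hσ := (h.σ_pos z hz).ne'
  rw [inv_mul_eq_iff_eq_mul₀ hσ]
  simp only [nablaTensor, tensorAlong]
  linarith

/-- The evolution equation of `k²` in coordinates. -/
theorem fderivWithin_curvSq_t (h : IsCoordFlow G U J s u σ S H) (hz : z ∈ s) :
    fderivWithin ℝ (curvSq G u H) s z (0, 1)
      = (σ z)⁻¹ * fderivWithin ℝ (fun z => (σ z)⁻¹ * fderivWithin ℝ (curvSq G u H) s z (1, 0))
          s z (1, 0)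
        - 2 * (stMetric G (liftST u z) (nablaH G U J s u σ H z) (nablaH G U J s u σ H z)
            - curvSq G u H z ^ 2)
        + 2 * curvSq G u H z ^ 2
        - 2 * tensorAlong G U J u H H z
        + 4 * curvSq G u H z * tensorAlong G U J u S S z
        + 2 * stMetric G (liftST u z) (RicciCurveFlow.curvature (stMetric G) (U ×ˢ J) (liftST u z)
            (hor S z) (hor S z) (fderivWithin ℝ (liftST u) s z (0, 1))) (hor H z)
        + 2 * tensorAlong G U J u S S z * tensorAlong G U J u H H z
        - 2 * nablaTensor G U J u S H z := by
  have hS := contDiffOn_hor h.smooth_S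
  have hH := contDiffOn_hor h.smooth_H
  have hT : ContDiffOn ℝ ∞ (fun z => tensorAlong G U J u S S z • vert E z) s :=
    (h.contDiffOn_tensorAlong h.smooth_S h.smooth_S).smul contDiffOn_vert
  have hm : ContDiffOn ℝ ∞ (fun z => curvSq G u H z + tensorAlong G U J u S S z) s :=
    (h.contDiffOn_metric hH hH).add (h.contDiffOn_tensorAlong h.smooth_S h.smooth_S)
  -- The commutator identity for S in the directions ∂_t and ∂_x, with the known values of ∇_x S and
  -- ∇_t S inserted.
  have hcomm := h.metricST.covDerivMap_covDerivMap_sub h.uniqueDiffOn h.subset_closure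
    h.contDiffOn_liftST h.mapsTo_liftST hS hz (0, 1) (1, 0)
  rw [covDerivMap_congr hz (fun z hz => h.covST_x_S hz) (0, 1),
    covDerivMap_congr hz (fun z hz => h.covST_t_S hz) (1, 0), h.liftST_x hz] at hcomm
  have hR : RicciCurveFlow.curvature (stMetric G) (U ×ˢ J) (liftST u z) (σ z • hor S z) (hor S z)
        (fderivWithin ℝ (liftST u) s z (0, 1))
      = σ z • RicciCurveFlow.curvature (stMetric G) (U ×ˢ J) (liftST u z) (hor S z) (hor S z)
        (fderivWithin ℝ (liftST u) s z (0, 1)) := by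
    simp only [RicciCurveFlow.curvature, LinearMap.coe_mk, AddHom.coe_mk, map_smul, smul_apply,
      smul_sub, smul_add]
  rw [hR, sub_eq_iff_eq_add] at hcomm
  have hl := h.covST_smul hz h.smooth_σ (hH.add hT) (0, 1)
  have hl' := h.covST_add hz hH hT (0, 1)
  rw [h.covST_smul hz (h.contDiffOn_tensorAlong h.smooth_S h.smooth_S) contDiffOn_vert] at hl'
  have hmS : ContDiffOn ℝ ∞
      (fun z => (curvSq G u H z + tensorAlong G U J u S S z) • hor S z) s := hm.smul hS
  have hr := h.covST_add hz (h.contDiffOn_nablaH.add h.contDiffOn_nablaVert) hmS (1, 0)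
  rw [h.covST_smul hz hm hS, h.covST_x_S hz,
    h.covST_add hz h.contDiffOn_nablaH h.contDiffOn_nablaVert] at hr
  rw [hl'] at hl
  have key := hl.symm.trans (hcomm.trans (congrArg (fun a => _ + a) hr))
  -- Pairing with H removes the undifferentiated S and ∂_t terms. The remaining product with ∇_t ∂_t
  -- equals -h(H, H), since the horizontal velocity in time is H.
  replace key := congrArg (fun a => stMetric G (liftST u z) a (hor H z)) key
  simp only [map_add, map_smul, add_apply, smul_apply, smul_eq_mul, metric_vert_hor,
    h.metric_covST_vert hz, h.evolution z hz, h.fderivWithin_σ hz, h.metric_comm hz (hor S z),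
    h.metric_H_S hz, mul_zero, add_zero, zero_add] at key
  have ht := h.fderivWithin_metric hz hH hH (0, 1)
  rw [h.metric_comm hz (hor H z)] at ht
  have hσ := h.σ_pos z hz
  have hv := h.metric_covST_nablaVert hz
  rw [h.fderivWithin_fderivWithin_curvSq hz]
  rw [inv_mul_eq_iff_eq_mul₀ hσ.ne'] at hv
  rw [hv] at key
  rw [show fderivWithin ℝ (curvSq G u H) s z (0, 1) = _ from ht]
  refine mul_left_cancel₀ hσ.ne' ?_
  have hfst : (hor H z).1 = H z := rfl
  simp only [curvSq, tensorAlong, nablaTensor, hfst] at key ⊢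
  field_simp
  linarith

end IsCoordFlow

end CoordinateFlow

/-! ### The differentials of a chart and of its inverse. -/

section Charts

variable {E : Type*} [NormedAddCommGroup E] [NormedSpace ℝ E]
  {H : Type*} [TopologicalSpace H] {I : ModelWithCorners ℝ E H}
  {N : Type*} [TopologicalSpace N] [ChartedSpace H N]

theorem coordMetric_apply (g : (q : N) → TangentSpace I q →L[ℝ] TangentSpace I q →L[ℝ] ℝ) (p : N)
    (y v w : E) :
    coordMetric I g p y v w
      = g ((extChartAt I p).symm y) (fromChart I p y v) (fromChart I p y w) := by
  rfl

variable [IsManifold I 1 N]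

theorem toChart_fromChart {p : N} {y : E} (hy : y ∈ (extChartAt I p).target) (v : E) :
    toChart I p ((extChartAt I p).symm y) (fromChart I p y v) = v :=
  DFunLike.congr_fun (mfderiv_extChartAt_comp_mfderivWithin_extChartAt_symm hy) v

theorem fromChart_toChart {p : N} {y : E} (hy : y ∈ (extChartAt I p).target)
    (v : TangentSpace I ((extChartAt I p).symm y)) :
    fromChart I p y (toChart I p ((extChartAt I p).symm y) v) = v :=
  DFunLike.congr_fun (mfderivWithin_extChartAt_symm_comp_mfderiv_extChartAt hy) v

theorem toChart_self (p : N) (v : TangentSpace I p) : toChart I p p v = v :=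
  DFunLike.congr_fun (mfderiv_extChartAt_self (I := I) (x := p)) v

theorem coordMetric_toChart (g : (q : N) → TangentSpace I q →L[ℝ] TangentSpace I q →L[ℝ] ℝ)
    {p q : N} (hq : q ∈ (extChartAt I p).source) (v w : TangentSpace I q) :
    coordMetric I g p (extChartAt I p q) (toChart I p q v) (toChart I p q w) = g q v w := by
  obtain ⟨y, hy, rfl⟩ : ∃ y ∈ (extChartAt I p).target, (extChartAt I p).symm y = q :=
    ⟨_, (extChartAt I p).map_source hq, (extChartAt I p).left_inv hq⟩
  rw [(extChartAt I p).right_inv hy, coordMetric_apply, fromChart_toChart hy, fromChart_toChart hy]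

/-- A coordinate vector, as a vector field on the domain of the chart. -/
theorem contMDiffOn_fromChart [IsManifold I ∞ N] (p : N) (v : E) :
    ContMDiffOn 𝓘(ℝ, E) (I.prod 𝓘(ℝ, E)) ∞
      (fun y => Bundle.TotalSpace.mk' E (E := (TangentSpace I : N → Type _))
        ((extChartAt I p).symm y) (fromChart I p y v)) (extChartAt I p).target := by
  have hsrc : ∀ y ∈ (extChartAt I p).target, (extChartAt I p).symm y ∈ (chartAt H p).source :=
    fun y hy => by
      rw [← extChartAt_source I]
      exact (extChartAt I p).map_target hy
  rw [(trivializationAt E (TangentSpace I) p).contMDiffOn_iff]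
  · refine ⟨contMDiffOn_extChartAt_symm p, ?_⟩
    -- In the trivialization centred at `p` this field is the constant `v`.
    refine (contMDiffOn_const (c := v)).congr fun y hy => ?_
    have h := TangentBundle.continuousLinearMapAt_trivializationAt (I := I) (𝕜 := ℝ) (hsrc y hy)
    have h2 := DFunLike.congr_fun h (fromChart I p y v)
    refine Eq.trans ?_ (h2.trans (toChart_fromChart hy v))
    rw [Bundle.Trivialization.continuousLinearMapAt_apply,
      Bundle.Trivialization.coe_linearMapAt_of_mem]
    exact hsrc y hy
  · intro y hy
    rw [Bundle.Trivialization.mem_source]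
    exact hsrc y hy

end Charts

/-! ### The metrics g(t) in a fixed chart. -/

section Family

variable {n : ℕ} {M : Type*} [TopologicalSpace M] [ChartedSpace (EuclideanSpace ℝ (Fin n)) M]
  [IsManifold (𝓡 n) ∞ M]

local notation "𝔼" => EuclideanSpace ℝ (Fin n)

theorem contDiffOn_coordMetric {g : MetricFamily n M} {T : ℝ} (hg : IsRicciFlow g T) (p : M) :
    ContDiffOn ℝ ∞ (fun q : 𝔼 × ℝ => coordMetric (𝓡 n) (g q.2).inner p q.1)
      ((extChartAt (𝓡 n) p).target ×ˢ Icc 0 T) := by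
  refine contDiffOn_clm_apply.2 fun v => contDiffOn_clm_apply.2 fun w => ?_
  simp only [coordMetric_apply]
  rw [← contMDiffOn_iff_contDiffOn]
  have hfst : ContMDiffOn 𝓘(ℝ, 𝔼 × ℝ) 𝓘(ℝ, 𝔼) ∞ (Prod.fst : 𝔼 × ℝ → 𝔼)
      ((extChartAt (𝓡 n) p).target ×ˢ Icc 0 T) := contDiff_fst.contMDiff.contMDiffOn
  have hsnd : ContMDiffOn 𝓘(ℝ, 𝔼 × ℝ) 𝓘(ℝ, ℝ) ∞ (Prod.snd : 𝔼 × ℝ → ℝ)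
      ((extChartAt (𝓡 n) p).target ×ˢ Icc 0 T) := contDiff_snd.contMDiff.contMDiffOn
  have hsymm := (contMDiffOn_extChartAt_symm (I := 𝓡 n) (n := ∞) p).comp hfst fun q hq => hq.1
  have hmet := hg.smooth.comp (hsymm.prodMk hsnd) fun q hq => ⟨mem_univ _, hq.2⟩
  have hv := (contMDiffOn_fromChart (I := 𝓡 n) p v).comp hfst fun q hq => hq.1
  have hw := (contMDiffOn_fromChart (I := 𝓡 n) p w).comp hfst fun q hq => hq.1
  intro q hq
  -- The function is treated as a section of the trivial line bundle, so that smoothness follows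
  -- from pairing a smooth bilinear form with two smooth fields.
  have : ContMDiffWithinAt 𝓘(ℝ, 𝔼 × ℝ) ((𝓡 n).prod 𝓘(ℝ)) ∞
      (fun q : 𝔼 × ℝ ↦ Bundle.TotalSpace.mk' ℝ (E := Bundle.Trivial M ℝ)
        ((extChartAt (𝓡 n) p).symm q.1) ((g q.2).inner ((extChartAt (𝓡 n) p).symm q.1)
        (fromChart (𝓡 n) p q.1 v) (fromChart (𝓡 n) p q.1 w)))
        ((extChartAt (𝓡 n) p).target ×ˢ Icc 0 T) q := by
    apply ContMDiffWithinAt.clm_bundle_apply₂ (F₁ := 𝔼) (F₂ := 𝔼)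
    · exact hmet q hq
    · exact hv q hq
    · exact hw q hq
  simp only [Bundle.contMDiffWithinAt_totalSpace] at this
  exact this.2

theorem isMetricFamilyOn_coordMetric {g : MetricFamily n M} {T : ℝ} (hT : 0 < T)
    (hg : IsRicciFlow g T) (p : M) :
    IsMetricFamilyOn (fun t => coordMetric (𝓡 n) (g t).inner p) (extChartAt (𝓡 n) p).target
      (Icc 0 T) where
  smooth := contDiffOn_coordMetric hg p
  symm t _ y _ v w := by
    rw [coordMetric_apply, coordMetric_apply, (g t).symm]
  pos t _ y hy v hv := by
    rw [coordMetric_apply]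
    refine (g t).pos _ _ fun h => hv ?_
    rw [← toChart_fromChart (I := 𝓡 n) hy v, h, map_zero]
  isOpen := isOpen_extChartAt_target p
  uniqueDiffOn := uniqueDiffOn_Icc hT

end Family

/-! ### Christoffel symbols under a change of coordinates. -/

section Transition

variable {F : Type*} [NormedAddCommGroup F] [NormedSpace ℝ F]

/-- The transformation law of the Christoffel symbols. -/
theorem IsMetricOn.fderiv_christoffel {G G' : F → F →L[ℝ] F →L[ℝ] ℝ} {U U' V : Set F} {ψ : F → F}
    (hG : IsMetricOn G U) (hG' : IsMetricOn G' U') (hU : IsOpen U) (hU' : IsOpen U')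
    (hV : IsOpen V) (hVU : V ⊆ U) (hψ : ContDiffOn ℝ ∞ ψ V) (hmaps : MapsTo ψ V U')
    (hpull : ∀ y ∈ V, ∀ a b, G y a b = G' (ψ y) (fderiv ℝ ψ y a) (fderiv ℝ ψ y b))
    {y : F} (hy : y ∈ V) (hsurj : Function.Surjective (fderiv ℝ ψ y)) (a b : F) :
    fderiv ℝ ψ y (christoffel G U y a b)
      = christoffel G' U' (ψ y) (fderiv ℝ ψ y a) (fderiv ℝ ψ y b)
        + fderiv ℝ (fderiv ℝ ψ) y a b := by
  have hyU := hVU hy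
  have hyU' := hmaps hy
  have hVy := hV.mem_nhds hy
  have hψy : ContDiffAt ℝ ∞ ψ y := hψ.contDiffAt hVy
  have hψ1 : HasFDerivAt ψ (fderiv ℝ ψ y) y := (hψy.differentiableAt (by simp)).hasFDerivAt
  have hψ2 : HasFDerivAt (fderiv ℝ ψ) (fderiv ℝ (fderiv ℝ ψ) y) y :=
    ((hψy.fderiv_right (m := ∞) (by simp)).differentiableAt (by simp)).hasFDerivAt
  have hG'1 : HasFDerivAt G' (fderivWithin ℝ G' U' (ψ y)) (ψ y) :=
    (hG'.differentiableOn _ hyU').hasFDerivWithinAt.hasFDerivAt (hU'.mem_nhds hyU')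
  -- The derivative of the pullback identity. In the Koszul combination the second-derivative terms
  -- cancel by symmetry, except those containing ψ''(a, b).
  have hdG : ∀ c d e : F, fderivWithin ℝ G U y c d e
      = fderivWithin ℝ G' U' (ψ y) (fderiv ℝ ψ y c) (fderiv ℝ ψ y d) (fderiv ℝ ψ y e)
        + G' (ψ y) (fderiv ℝ (fderiv ℝ ψ) y c d) (fderiv ℝ ψ y e)
        + G' (ψ y) (fderiv ℝ ψ y d) (fderiv ℝ (fderiv ℝ ψ) y c e) := by
    intro c d e
    rw [← hG.fderivWithin_apply hyU, fderivWithin_of_isOpen hU hyU]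
    have h1 := ((hG'1.comp y hψ1).clm_apply (hψ2.clm_apply (hasFDerivAt_const d y))).clm_apply
      (hψ2.clm_apply (hasFDerivAt_const e y))
    have h2 : (fun z => G z d e) =ᶠ[nhds y]
        fun z => (G' ∘ ψ) z (fderiv ℝ ψ z d) (fderiv ℝ ψ z e) := by
      filter_upwards [hVy] with z hz using hpull z hz d e
    rw [h2.fderiv_eq, h1.fderiv]
    simp
    ring
  have hsymm : ∀ c d, fderiv ℝ (fderiv ℝ ψ) y c d = fderiv ℝ (fderiv ℝ ψ) y d c := by
    have h2 : IsSymmSndFDerivAt ℝ ψ y := hψy.isSymmSndFDerivAt (by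
      rw [minSmoothness_of_isRCLikeNormedField]
      exact WithTop.coe_le_coe.2 (le_top : (2 : ℕ∞) ≤ ⊤))
    exact fun c d => h2.eq c d
  refine hG'.ext_metric hyU' fun e => ?_
  obtain ⟨c, rfl⟩ := hsurj e
  rw [← hpull y hy, hG.metric_christoffel hyU, map_add, add_apply, hG'.metric_christoffel hyU',
    christoffelFirst_apply, christoffelFirst_apply, hdG, hdG, hdG, hsymm b a, hsymm c a, hsymm c b,
    hG'.symm _ hyU' (fderiv ℝ (fderiv ℝ ψ) y a c)]
  ring

end Transition

/-! ### Chart independence of the covariant derivative along a curve. -/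

section Along

variable {E : Type*} [NormedAddCommGroup E] [NormedSpace ℝ E]
  {H : Type*} [TopologicalSpace H] {I : ModelWithCorners ℝ E H}
  {N : Type*} [TopologicalSpace N] [ChartedSpace H N]

/-- The change of coordinates from the preferred chart at `q` to the one at `p`. -/
def transition (I : ModelWithCorners ℝ E H) (p q : N) : E → E :=
  extChartAt I p ∘ (extChartAt I q).symm

/-- The domain of the change of coordinates. -/
def overlap (I : ModelWithCorners ℝ E H) (p q : N) : Set E :=
  (extChartAt I q).target ∩ (extChartAt I q).symm ⁻¹' (extChartAt I p).source

theorem mem_overlap {p q r : N} (hp : r ∈ (extChartAt I p).source)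
    (hq : r ∈ (extChartAt I q).source) : extChartAt I q r ∈ overlap I p q := by
  refine ⟨(extChartAt I q).map_source hq, ?_⟩
  rw [mem_preimage, (extChartAt I q).left_inv hq]
  exact hp

theorem chartRegion_univ (p : N) : chartRegion I univ p = (extChartAt I p).target := by
  simp [chartRegion]

theorem isOpen_overlap [I.Boundaryless] (p q : N) : IsOpen (overlap I p q) :=
  (continuousOn_extChartAt_symm q).isOpen_inter_preimage (isOpen_extChartAt_target q)
    (isOpen_extChartAt_source p)

variable [IsManifold I ∞ N]

theorem contDiffOn_transition (p q : N) : ContDiffOn ℝ ∞ (transition I p q) (overlap I p q) := by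
  rw [← contMDiffOn_iff_contDiffOn]
  exact (contMDiffOn_extChartAt (I := I) (n := ∞) (x := p)).comp
    ((contMDiffOn_extChartAt_symm (I := I) (n := ∞) q).mono inter_subset_left)
    fun y hy => by simpa using hy.2

theorem hasDerivAt_extChartAt_comp {γ : ℝ → N} {x : ℝ} {p : N}
    (hγ : MDifferentiableAt 𝓘(ℝ, ℝ) I γ x) (hp : γ x ∈ (extChartAt I p).source) :
    HasDerivAt (fun x' => extChartAt I p (γ x')) (toChart I p (γ x) (velocity I γ x)) x := by
  have : IsManifold I 1 N := IsManifold.of_le (n := ∞) (by simp)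
  have h1 : HasMFDerivAt I 𝓘(ℝ, E) (extChartAt I p) (γ x) (toChart I p (γ x)) :=
    (mdifferentiableAt_extChartAt (by simpa using hp)).hasMFDerivAt
  have h2 := (h1.comp x hγ.hasMFDerivAt)
  rw [hasMFDerivAt_iff_hasFDerivAt] at h2
  have h3 : HasFDerivAt (fun x' => extChartAt I p (γ x'))
      ((toChart I p (γ x) : E →L[ℝ] E) ∘L (mfderiv 𝓘(ℝ, ℝ) I γ x : ℝ →L[ℝ] E)) x := h2
  exact h3.hasDerivAt

variable [I.Boundaryless]

theorem fderiv_transition {p q : N} {y : E} (hy : y ∈ overlap I p q) (v : E) :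
    fderiv ℝ (transition I p q) y v
      = toChart I p ((extChartAt I q).symm y) (fromChart I q y v) := by
  have : IsManifold I 1 N := IsManifold.of_le (n := ∞) (by simp)
  have h1 : MDifferentiableWithinAt 𝓘(ℝ, E) I (extChartAt I q).symm (range I) y :=
    mdifferentiableWithinAt_extChartAt_symm hy.1
  have h2 : MDifferentiableAt I 𝓘(ℝ, E) (extChartAt I p) ((extChartAt I q).symm y) :=
    mdifferentiableAt_extChartAt (by simpa using hy.2)
  have h3 := mfderiv_comp_mfderivWithin y h2 h1
    ((I.uniqueMDiffOn _ (extChartAt_target_subset_range q hy.1)))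
  rw [I.range_eq_univ, mfderivWithin_univ, mfderiv_eq_fderiv] at h3
  have h4 := DFunLike.congr_fun h3 v
  refine h4.trans ?_
  rw [toChart, fromChart, I.range_eq_univ]
  rfl

theorem toChart_eq_fderiv_transition {p q r : N} (hp : r ∈ (extChartAt I p).source)
    (hq : r ∈ (extChartAt I q).source) (v : TangentSpace I r) :
    toChart I p r v = fderiv ℝ (transition I p q) (extChartAt I q r) (toChart I q r v) := by
  have : IsManifold I 1 N := IsManifold.of_le (n := ∞) (by simp)
  obtain ⟨y, hy, rfl⟩ : ∃ y ∈ (extChartAt I q).target, (extChartAt I q).symm y = r :=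
    ⟨_, (extChartAt I q).map_source hq, (extChartAt I q).left_inv hq⟩
  rw [(extChartAt I q).right_inv hy, fderiv_transition ⟨hy, hp⟩, fromChart_toChart hy]

theorem differentiableAt_fderiv_transition {p q : N} {y : E} (hy : y ∈ overlap I p q) :
    DifferentiableAt ℝ (fderiv ℝ (transition I p q)) y :=
  (((contDiffOn_transition p q).contDiffAt ((isOpen_overlap p q).mem_nhds hy)).fderiv_right
    (m := ∞) (by simp)).differentiableAt (by simp)

/-- The covariant derivative along a curve, computed in an arbitrary chart. -/
theorem toChart_covDerivAlong
    {g : (q : N) → TangentSpace I q →L[ℝ] TangentSpace I q →L[ℝ] ℝ}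
    (hg : ∀ p, IsMetricOn (coordMetric I g p) (extChartAt I p).target)
    {γ : ℝ → N} {V : (x : ℝ) → TangentSpace I (γ x)} {x : ℝ} {p : N}
    (hγ : MDifferentiableAt 𝓘(ℝ, ℝ) I γ x) (hp : γ x ∈ (extChartAt I p).source)
    (hV : DifferentiableAt ℝ (fun x' => toChart I p (γ x') (V x')) x) :
    toChart I p (γ x) (covDerivAlong I g univ γ V x)
      = deriv (fun x' => toChart I p (γ x') (V x')) x
        + christoffel (coordMetric I g p) (extChartAt I p).target (extChartAt I p (γ x))
            (deriv (fun x' => extChartAt I p (γ x')) x) (toChart I p (γ x) (V x)) := by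
  have : IsManifold I 1 N := IsManifold.of_le (n := ∞) (by simp)
  set q := γ x with hq
  have hqq : γ x ∈ (extChartAt I q).source := mem_extChartAt_source q
  have hy : extChartAt I q (γ x) ∈ overlap I p q := mem_overlap hp hqq
  have hy' : extChartAt I p (γ x) ∈ overlap I q p := mem_overlap hqq hp
  have hpx := hasDerivAt_extChartAt_comp hγ hp
  have hqx := hasDerivAt_extChartAt_comp hγ hqq
  have hevp : ∀ᶠ x' in nhds x, γ x' ∈ (extChartAt I p).source :=
    hγ.continuousAt.eventually_mem ((isOpen_extChartAt_source p).mem_nhds hp)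
  have hevq : ∀ᶠ x' in nhds x, γ x' ∈ (extChartAt I q).source :=
    hγ.continuousAt.eventually_mem ((isOpen_extChartAt_source q).mem_nhds hqq)
  have hW : DifferentiableAt ℝ (fun x' => toChart I q (γ x') (V x')) x := by
    have h1 : DifferentiableAt ℝ (fun x' => fderiv ℝ (transition I q p) (extChartAt I p (γ x'))
        (toChart I p (γ x') (V x'))) x :=
      ((differentiableAt_fderiv_transition hy').comp x hpx.differentiableAt).clm_apply hV
    refine h1.congr_of_eventuallyEq ?_
    filter_upwards [hevp, hevq] with x' h1 h2 using toChart_eq_fderiv_transition h2 h1 _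
  -- Passing from the chart at `q` to the one at `p` adds the second derivative of the transition
  -- map, evaluated on the velocity and `V`; it cancels the inhomogeneous term in the transformation
  -- law `htr`.
  have hd : HasDerivAt (fun x' => toChart I p (γ x') (V x'))
      (fderiv ℝ (fderiv ℝ (transition I p q)) (extChartAt I q (γ x))
          (toChart I q (γ x) (velocity I γ x)) (toChart I q (γ x) (V x))
        + fderiv ℝ (transition I p q) (extChartAt I q (γ x))
          (deriv (fun x' => toChart I q (γ x') (V x')) x)) x := by
    have h1 : HasDerivAt (fun x' => fderiv ℝ (transition I p q) (extChartAt I q (γ x'))) _ x :=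
      (differentiableAt_fderiv_transition hy).hasFDerivAt.comp_hasDerivAt x hqx
    refine (h1.clm_apply hW.hasDerivAt).congr_of_eventuallyEq ?_
    filter_upwards [hevp, hevq] with x' h1 h2 using toChart_eq_fderiv_transition h1 h2 _
  have hpull : ∀ y ∈ overlap I p q, ∀ a b, coordMetric I g q y a b
      = coordMetric I g p (transition I p q y) (fderiv ℝ (transition I p q) y a)
        (fderiv ℝ (transition I p q) y b) := by
    intro y hy a b
    rw [fderiv_transition hy, fderiv_transition hy, coordMetric_apply]
    exact (coordMetric_toChart g hy.2 _ _).symm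
  have hsurj : Function.Surjective (fderiv ℝ (transition I p q) (extChartAt I q (γ x))) := by
    intro v
    obtain ⟨w, hw⟩ := (isInvertible_mfderiv_extChartAt (I := I) hp).surjective v
    exact ⟨toChart I q (γ x) w, (toChart_eq_fderiv_transition hp hqq w).symm.trans hw⟩
  have htr := (hg q).fderiv_christoffel (hg p) (isOpen_extChartAt_target q)
    (isOpen_extChartAt_target p) (isOpen_overlap p q) inter_subset_left
    (contDiffOn_transition p q) (fun y hy => (extChartAt I p).map_source hy.2) hpull hy hsurj
    (toChart I q (γ x) (velocity I γ x)) (toChart I q (γ x) (V x))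
  have hbase : transition I p q (extChartAt I q (γ x)) = extChartAt I p (γ x) := by
    simp only [transition, Function.comp_apply, (extChartAt I q).left_inv hqq]
  rw [hbase, ← toChart_eq_fderiv_transition hp hqq, ← toChart_eq_fderiv_transition hp hqq] at htr
  rw [hd.deriv, hpx.deriv, add_assoc, add_comm, add_assoc, ← htr,
    toChart_eq_fderiv_transition hp hqq, ← map_add]
  congr 1
  -- A chart has identity differential at its own centre, where `covDerivAlong` is defined.
  have hid : ∀ v, toChart I q (γ x) v = v := toChart_self q
  rw [hid, hid, hid, covDerivAlong, christoffelAt, chartRegion_univ]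

end Along

/-! ### Partial derivatives on regions of the (x,t)-plane. -/

section Slices

variable {F : Type*} [NormedAddCommGroup F] [NormedSpace ℝ F] {O K : Set ℝ} {f : ℝ × ℝ → F}
  {x t : ℝ}

theorem hasDerivAt_slice (hO : IsOpen O) (hx : x ∈ O) (ht : t ∈ K)
    (hf : DifferentiableWithinAt ℝ f (O ×ˢ K) (x, t)) :
    HasDerivAt (fun x' => f (x', t)) (fderivWithin ℝ f (O ×ˢ K) (x, t) (1, 0)) x := by
  have h1 : HasDerivWithinAt (fun x' : ℝ => (x', t)) ((1 : ℝ), (0 : ℝ)) O x :=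
    (hasDerivWithinAt_id x O).prodMk (hasDerivWithinAt_const x O t)
  have h2 := HasFDerivWithinAt.comp_hasDerivWithinAt (t := O ×ˢ K) x hf.hasFDerivWithinAt h1
    fun x' hx' => ⟨hx', ht⟩
  exact h2.hasDerivAt (hO.mem_nhds hx)

theorem hasDerivWithinAt_slice (hx : x ∈ O) (hf : DifferentiableWithinAt ℝ f (O ×ˢ K) (x, t)) :
    HasDerivWithinAt (fun t' => f (x, t')) (fderivWithin ℝ f (O ×ˢ K) (x, t) (0, 1)) K t := by
  have h1 : HasDerivWithinAt (fun t' : ℝ => (x, t')) ((0 : ℝ), (1 : ℝ)) K t :=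
    (hasDerivWithinAt_const t K x).prodMk (hasDerivWithinAt_id t K)
  exact HasFDerivWithinAt.comp_hasDerivWithinAt (t := O ×ˢ K) t hf.hasFDerivWithinAt h1
    fun t' ht' => ⟨hx, ht'⟩

/-- This supplies symmetry of second derivatives up to the times 0 and T after localising; it rests
on A ∩ closure B ⊆ closure (A ∩ B) for open A. -/
theorem prod_subset_closure_interior {J A : Set ℝ} (hO : IsOpen O) (hA : IsOpen A)
    (hJ : J ⊆ closure (interior J)) :
    O ×ˢ (J ∩ A) ⊆ closure (interior (O ×ˢ (J ∩ A))) := by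
  rw [interior_prod_eq, closure_prod_eq, hO.interior_eq, interior_inter, hA.interior_eq]
  refine prod_mono subset_closure ?_
  rw [inter_comm, inter_comm (interior J)]
  exact (inter_subset_inter_right A hJ).trans hA.inter_closure

end Slices

/-! ### The curve shrinking flow in a chart. -/

section Flow

variable {n : ℕ} {M : Type*} [TopologicalSpace M] [ChartedSpace (EuclideanSpace ℝ (Fin n)) M]
  [IsManifold (𝓡 n) ∞ M]

local notation "𝔼" => EuclideanSpace ℝ (Fin n)

variable {g : MetricFamily n M} {T : ℝ} {c : Circle → ℝ → M} {p : M} {O A : Set ℝ}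

/-- The flow read in the preferred chart at `p`. -/
def flowChart (p : M) (c : Circle → ℝ → M) (z : ℝ × ℝ) : 𝔼 :=
  extChartAt (𝓡 n) p (curveAt c z.2 z.1)

/-- The unit tangent read in the preferred chart at `p`. -/
def unitSChart (p : M) (g : MetricFamily n M) (c : Circle → ℝ → M) (z : ℝ × ℝ) : 𝔼 :=
  toChart (𝓡 n) p (curveAt c z.2 z.1) (unitS g c z.1 z.2)

/-- The curvature vector read in the preferred chart at `p`. -/
def vecHChart (p : M) (g : MetricFamily n M) (c : Circle → ℝ → M) (z : ℝ × ℝ) : 𝔼 :=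
  toChart (𝓡 n) p (curveAt c z.2 z.1) (vecH g c z.1 z.2)

theorem IsCurveShrinkingFlow.contMDiffOn_curve (hc : IsCurveShrinkingFlow g T c) :
    ContMDiffOn 𝓘(ℝ, ℝ × ℝ) (𝓡 n) ∞ (fun z : ℝ × ℝ => curveAt c z.2 z.1) (univ ×ˢ Icc 0 T) := by
  have hfst : ContMDiff 𝓘(ℝ, ℝ × ℝ) 𝓘(ℝ, ℝ) ∞ (Prod.fst : ℝ × ℝ → ℝ) := contDiff_fst.contMDiff
  have hsnd : ContMDiff 𝓘(ℝ, ℝ × ℝ) 𝓘(ℝ, ℝ) ∞ (Prod.snd : ℝ × ℝ → ℝ) := contDiff_snd.contMDiff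
  have h := (contMDiff_circleExp (m := ∞)).comp hfst
  exact hc.smooth.comp (h.prodMk hsnd).contMDiffOn fun z hz => ⟨mem_univ _, hz.2⟩

theorem IsCurveShrinkingFlow.mdifferentiableAt_curveAt (hc : IsCurveShrinkingFlow g T c) {x t : ℝ}
    (ht : t ∈ Icc 0 T) : MDifferentiableAt 𝓘(ℝ, ℝ) (𝓡 n) (curveAt c t) x := by
  have h1 : ContMDiffOn 𝓘(ℝ, ℝ) 𝓘(ℝ, ℝ × ℝ) ∞ (fun x' : ℝ => (x', t)) univ :=
    (contDiff_prodMk_left t).contMDiff.contMDiffOn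
  have h2 := hc.contMDiffOn_curve.comp h1 fun x' _ => ⟨mem_univ _, ht⟩
  exact ((contMDiffOn_univ.1 h2).mdifferentiable (by simp)) x

theorem IsCurveShrinkingFlow.mdifferentiableWithinAt_t (hc : IsCurveShrinkingFlow g T c)
    {t : ℝ} (ht : t ∈ Icc 0 T) (x : ℝ) :
    MDifferentiableWithinAt 𝓘(ℝ, ℝ) (𝓡 n) (fun t' => curveAt c t' x) (Icc 0 T) t := by
  have h2 : ContMDiffOn 𝓘(ℝ, ℝ) 𝓘(ℝ, ℝ × ℝ) ∞ (fun t' : ℝ => (x, t')) (Icc 0 T) :=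
    (contDiff_prodMk_right x).contMDiff.contMDiffOn
  exact (hc.contMDiffOn_curve.comp h2 fun t' ht' => ⟨mem_univ _, ht'⟩).mdifferentiableOn
    (by simp) _ ht

/-- By continuity one chart serves for a product neighbourhood, relatively open in time. All
derivatives of the proof can then be taken in that chart. -/
theorem IsCurveShrinkingFlow.exists_nhds (hc : IsCurveShrinkingFlow g T c) {x t : ℝ}
    (ht : t ∈ Icc 0 T) : ∃ O A : Set ℝ, IsOpen O ∧ IsOpen A ∧ x ∈ O ∧ t ∈ A ∧
      ∀ z ∈ O ×ˢ (Icc 0 T ∩ A), curveAt c z.2 z.1 ∈ (extChartAt (𝓡 n) (curveAt c t x)).source := by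
  have h1 := hc.contMDiffOn_curve.continuousOn (x, t) ⟨mem_univ _, ht⟩
  have h2 := h1 (extChartAt_source_mem_nhds (I := 𝓡 n) (curveAt c t x))
  obtain ⟨W, hW, hmem, hsub⟩ := mem_nhdsWithin.1 h2
  obtain ⟨O, A, hO, hA, hx, htA, hOA⟩ := isOpen_prod_iff.1 hW x t hmem
  exact ⟨O, A, hO, hA, hx, htA, fun z hz => hsub ⟨hOA ⟨hz.1, hz.2.2⟩, mem_univ _, hz.2.1⟩⟩

theorem Icc_subset_closure_interior (hT : 0 < T) : Icc 0 T ⊆ closure (interior (Icc 0 T)) := by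
  rw [interior_Icc, closure_Ioo hT.ne]

theorem IsCurveShrinkingFlow.contDiffOn_flowChart (hc : IsCurveShrinkingFlow g T c)
    (hsrc : ∀ z ∈ O ×ˢ (Icc 0 T ∩ A), curveAt c z.2 z.1 ∈ (extChartAt (𝓡 n) p).source) :
    ContDiffOn ℝ ∞ (flowChart (n := n) p c) (O ×ˢ (Icc 0 T ∩ A)) := by
  rw [← contMDiffOn_iff_contDiffOn]
  exact (contMDiffOn_extChartAt (I := 𝓡 n) (n := ∞) (x := p)).comp
    (hc.contMDiffOn_curve.mono (prod_mono (subset_univ _) inter_subset_left))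
    fun z hz => by simpa using hsrc z hz

theorem IsCurveShrinkingFlow.flowChart_x (hc : IsCurveShrinkingFlow g T c) (hO : IsOpen O)
    (hsrc : ∀ z ∈ O ×ˢ (Icc 0 T ∩ A), curveAt c z.2 z.1 ∈ (extChartAt (𝓡 n) p).source)
    {z : ℝ × ℝ} (hz : z ∈ O ×ˢ (Icc 0 T ∩ A)) :
    fderivWithin ℝ (flowChart (n := n) p c) (O ×ˢ (Icc 0 T ∩ A)) z (1, 0)
      = toChart (𝓡 n) p (curveAt c z.2 z.1) (tangentX c z.1 z.2) := by
  have h1 := hasDerivAt_slice (x := z.1) (t := z.2) hO hz.1 hz.2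
    ((hc.contDiffOn_flowChart hsrc).differentiableOn (by simp) z hz)
  exact h1.unique (hasDerivAt_extChartAt_comp (hc.mdifferentiableAt_curveAt hz.2.1) (hsrc z hz))

theorem IsCurveShrinkingFlow.flowChart_t (hc : IsCurveShrinkingFlow g T c) (hT : 0 < T)
    (hA : IsOpen A)
    (hsrc : ∀ z ∈ O ×ˢ (Icc 0 T ∩ A), curveAt c z.2 z.1 ∈ (extChartAt (𝓡 n) p).source)
    {z : ℝ × ℝ} (hz : z ∈ O ×ˢ (Icc 0 T ∩ A)) :
    fderivWithin ℝ (flowChart (n := n) p c) (O ×ˢ (Icc 0 T ∩ A)) z (0, 1) = vecHChart p g c z := by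
  have : IsManifold (𝓡 n) 1 M := IsManifold.of_le (n := ∞) (by simp)
  have h1 := hasDerivWithinAt_slice (x := z.1) (t := z.2) hz.1
    ((hc.contDiffOn_flowChart hsrc).differentiableOn (by simp) z hz)
  have hmd := hc.mdifferentiableWithinAt_t hz.2.1 z.1
  have h3 : HasMFDerivAt (𝓡 n) 𝓘(ℝ, 𝔼) (extChartAt (𝓡 n) p) (curveAt c z.2 z.1)
      (toChart (𝓡 n) p (curveAt c z.2 z.1)) :=
    (mdifferentiableAt_extChartAt (by simpa using hsrc z hz)).hasMFDerivAt
  have h4 := HasMFDerivAt.comp_hasMFDerivWithinAt z.2 h3 hmd.hasMFDerivWithinAt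
  rw [hasMFDerivWithinAt_iff_hasFDerivWithinAt] at h4
  have h5 : HasFDerivWithinAt (fun t' => flowChart (n := n) p c (z.1, t'))
      ((toChart (𝓡 n) p (curveAt c z.2 z.1) : 𝔼 →L[ℝ] 𝔼) ∘L
        (mfderivWithin 𝓘(ℝ, ℝ) (𝓡 n) (fun t' => curveAt c t' z.1) (Icc 0 T) z.2 : ℝ →L[ℝ] 𝔼))
      (Icc 0 T) z.2 := h4
  have h6 := h5.hasDerivWithinAt.mono (inter_subset_left (t := A))
  -- Both are time derivatives within the localised interval, where derivatives are unique even at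
  -- an endpoint.
  have h7 := (((uniqueDiffOn_Icc hT).inter hA) z.2 hz.2).eq_deriv _ h1 h6
  refine h7.trans ?_
  rw [vecHChart, ← hc.evolution z.1 z.2 hz.2.1]
  rfl

/-- Smoothness of H is read off from the flow equation, which makes it a time derivative. The
curvature equation needs `toChart_covDerivAlong`, since `vecH` at each point is computed in the
chart centred there and not in the chart at `p`. -/
theorem isCoordFlow_chart (hT : 0 < T) (hg : IsRicciFlow g T) (hc : IsCurveShrinkingFlow g T c)
    (hO : IsOpen O) (hA : IsOpen A)
    (hsrc : ∀ z ∈ O ×ˢ (Icc 0 T ∩ A), curveAt c z.2 z.1 ∈ (extChartAt (𝓡 n) p).source) :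
    IsCoordFlow (fun t => coordMetric (𝓡 n) (g t).inner p) (extChartAt (𝓡 n) p).target (Icc 0 T)
      (O ×ˢ (Icc 0 T ∩ A)) (flowChart (n := n) p c) (fun z => speed g c z.1 z.2) (unitSChart p g c)
      (vecHChart p g c) := by
  have : IsManifold (𝓡 n) 1 M := IsManifold.of_le (n := ∞) (by simp)
  have hud : UniqueDiffOn ℝ (O ×ˢ (Icc 0 T ∩ A)) :=
    hO.uniqueDiffOn.prod ((uniqueDiffOn_Icc hT).inter hA)
  have hmet := isMetricFamilyOn_coordMetric hT hg p
  have hu := hc.contDiffOn_flowChart hsrc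
  have hux : ContDiffOn ℝ ∞
      (fun z => fderivWithin ℝ (flowChart (n := n) p c) (O ×ˢ (Icc 0 T ∩ A)) z (1, 0))
      (O ×ˢ (Icc 0 T ∩ A)) := (hu.fderivWithin hud (by simp)).clm_apply contDiffOn_const
  have hut : ContDiffOn ℝ ∞
      (fun z => fderivWithin ℝ (flowChart (n := n) p c) (O ×ˢ (Icc 0 T ∩ A)) z (0, 1))
      (O ×ˢ (Icc 0 T ∩ A)) := (hu.fderivWithin hud (by simp)).clm_apply contDiffOn_const
  have hmaps : ∀ z ∈ O ×ˢ (Icc 0 T ∩ A), flowChart (n := n) p c z ∈ (extChartAt (𝓡 n) p).target :=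
    fun z hz => (extChartAt (𝓡 n) p).map_source (hsrc z hz)
  have hinner : ∀ z ∈ O ×ˢ (Icc 0 T ∩ A),
      (g z.2).inner (curveAt c z.2 z.1) (tangentX c z.1 z.2) (tangentX c z.1 z.2)
        = coordMetric (𝓡 n) (g z.2).inner p (flowChart (n := n) p c z)
          (fderivWithin ℝ (flowChart (n := n) p c) (O ×ˢ (Icc 0 T ∩ A)) z (1, 0))
          (fderivWithin ℝ (flowChart (n := n) p c) (O ×ˢ (Icc 0 T ∩ A)) z (1, 0)) := fun z hz => by
    rw [hc.flowChart_x hO hsrc hz]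
    exact (coordMetric_toChart _ (hsrc z hz) _ _).symm
  have hpos : ∀ z ∈ O ×ˢ (Icc 0 T ∩ A),
      0 < (g z.2).inner (curveAt c z.2 z.1) (tangentX c z.1 z.2) (tangentX c z.1 z.2) :=
    fun z hz => (g z.2).pos _ _ (hc.immersed z.1 z.2 hz.2.1)
  have hσ : ContDiffOn ℝ ∞ (fun z : ℝ × ℝ => speed g c z.1 z.2) (O ×ˢ (Icc 0 T ∩ A)) := by
    have h1 : ContDiffOn ℝ ∞ (fun z : ℝ × ℝ => (g z.2).inner (curveAt c z.2 z.1)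
        (tangentX c z.1 z.2) (tangentX c z.1 z.2)) (O ×ˢ (Icc 0 T ∩ A)) := by
      refine ContDiffOn.congr ?_ hinner
      exact ((hmet.smooth.comp (hu.prodMk contDiff_snd.contDiffOn)
        fun z hz => ⟨hmaps z hz, hz.2.1⟩).clm_apply hux).clm_apply hux
    exact h1.sqrt fun z hz => (hpos z hz).ne'
  have hσpos : ∀ z ∈ O ×ˢ (Icc 0 T ∩ A), 0 < speed g c z.1 z.2 :=
    fun z hz => Real.sqrt_pos.2 (hpos z hz)
  have hSeq : ∀ z ∈ O ×ˢ (Icc 0 T ∩ A), unitSChart p g c z = (speed g c z.1 z.2)⁻¹ •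
      fderivWithin ℝ (flowChart (n := n) p c) (O ×ˢ (Icc 0 T ∩ A)) z (1, 0) := fun z hz => by
    rw [unitSChart, unitS, map_smul, hc.flowChart_x hO hsrc hz]
  have hS : ContDiffOn ℝ ∞ (unitSChart p g c) (O ×ˢ (Icc 0 T ∩ A)) :=
    ((hσ.inv fun z hz => (hσpos z hz).ne').smul hux).congr hSeq
  refine ⟨hmet, hud, prod_subset_closure_interior hO hA (Icc_subset_closure_interior hT), hu, hσ,
    hS, hut.congr fun z hz => (hc.flowChart_t hT hA hsrc hz).symm, hmaps, fun z hz => hz.2.1, hσpos,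
    ?_, ?_, ?_, fun z hz => hc.flowChart_t hT hA hsrc hz⟩
  · intro z hz
    rw [hSeq z hz, smul_inv_smul₀ (hσpos z hz).ne']
  · intro z hz
    have h1 := hσpos z hz
    have h2 := Real.sq_sqrt (hpos z hz).le
    rw [hinner z hz] at h2
    rw [hSeq z hz]
    simp only [map_smul, smul_apply, smul_eq_mul]
    rw [← h2, ← hinner z hz, ← speed]
    field_simp
  · intro z hz
    have hd := hasDerivAt_slice (x := z.1) (t := z.2) hO hz.1 hz.2
      (hS.differentiableOn (by simp) z hz)
    have hdu := hasDerivAt_slice (x := z.1) (t := z.2) hO hz.1 hz.2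
      (hu.differentiableOn (by simp) z hz)
    have h1 := toChart_covDerivAlong (I := 𝓡 n) (g := (g z.2).inner)
      (fun p => (isMetricFamilyOn_coordMetric hT hg p).isMetricOn hz.2.1)
      (V := fun x' => unitS g c x' z.2)
      (hc.mdifferentiableAt_curveAt (x := z.1) hz.2.1) (hsrc z hz) hd.differentiableAt
    rw [show deriv (fun x' => toChart (𝓡 n) p (curveAt c z.2 x') (unitS g c x' z.2)) z.1 = _ from
      hd.deriv, show deriv (fun x' => extChartAt (𝓡 n) p (curveAt c z.2 x')) z.1 = _ from
      hdu.deriv] at h1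
    rw [vecHChart, vecH, map_smul, smul_inv_smul₀ (hσpos z hz).ne']
    exact h1.symm

end Flow

/-! ### Connection and curvature depend only on the metric within the region. -/

section Congr

variable {F : Type*} [NormedAddCommGroup F] [NormedSpace ℝ F] {G G' : F → F →L[ℝ] F →L[ℝ] ℝ}
  {U : Set F} {y : F}

theorem christoffel_congr (h : EqOn G G' U) (hy : y ∈ U) :
    christoffel G U y = christoffel G' U y := by
  rw [christoffel, christoffel, christoffelFirst, christoffelFirst, fderivWithin_congr h (h hy),
    h hy]

theorem curvature_congr (h : EqOn G G' U) (hy : y ∈ U) (v w : F) :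
    curvature G U y v w = curvature G' U y v w := by
  have h1 : EqOn (christoffel G U) (christoffel G' U) U := fun z hz => christoffel_congr h hz
  ext u
  simp only [curvature, LinearMap.coe_mk, AddHom.coe_mk]
  rw [fderivWithin_congr h1 (h1 hy), h1 hy]

end Congr

/-! ### The product metric, Ric and its covariant derivative in a chart. -/

section Product

variable {n : ℕ} {M : Type*} [TopologicalSpace M] [ChartedSpace (EuclideanSpace ℝ (Fin n)) M]

local notation "𝔼" => EuclideanSpace ℝ (Fin n)
local notation "𝓡t" => ModelWithCorners.prod (𝓡 n) 𝓘(ℝ, ℝ)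

theorem extChartAt_spaceTime_apply (p q : M) (t r : ℝ) :
    extChartAt 𝓡t (p, t) (q, r) = (extChartAt (𝓡 n) p q, r) := by
  rfl

theorem extChartAt_spaceTime_symm_apply (p : M) (t : ℝ) (y : 𝔼 × ℝ) :
    (extChartAt 𝓡t (p, t)).symm y = ((extChartAt (𝓡 n) p).symm y.1, y.2) := by
  rfl

theorem chartRegion_spaceTime (p : M) (t T : ℝ) :
    chartRegion 𝓡t (spaceTime M T) (p, t) = (extChartAt (𝓡 n) p).target ×ˢ Icc 0 T := by
  ext y
  simp only [chartRegion, mem_inter_iff, mem_preimage, extChartAt_spaceTime_symm_apply]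
  have h : (extChartAt 𝓡t (p, t)).target = (extChartAt (𝓡 n) p).target ×ˢ univ := by
    rw [extChartAt_prod, extChartAt_model_space_eq_id]
    rfl
  rw [h]
  simp [spaceTime]

variable [IsManifold (𝓡 n) ∞ M]
  {g : MetricFamily n M} {T t : ℝ} {c : Circle → ℝ → M} {p : M}

theorem fromChart_spaceTime {y : 𝔼} (hy : y ∈ (extChartAt (𝓡 n) p).target) (t r : ℝ)
    (v : 𝔼 × ℝ) :
    (fromChart 𝓡t (p, t) (y, r) v : 𝔼 × ℝ) = (fromChart (𝓡 n) p y v.1, v.2) := by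
  have : IsManifold (𝓡 n) 1 M := IsManifold.of_le (n := ∞) (by simp)
  have h1 : HasMFDerivAt 𝓘(ℝ, 𝔼) (𝓡 n) (extChartAt (𝓡 n) p).symm y (fromChart (𝓡 n) p y) := by
    have h := (mdifferentiableWithinAt_extChartAt_symm (I := 𝓡 n) hy).hasMFDerivWithinAt
    exact h.hasMFDerivAt (by simp)
  have h2 : HasMFDerivAt 𝓘(ℝ, 𝔼 × ℝ) 𝓘(ℝ, 𝔼) (Prod.fst : 𝔼 × ℝ → 𝔼) (y, r)
      (ContinuousLinearMap.fst ℝ 𝔼 ℝ) := hasFDerivAt_fst.hasMFDerivAt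
  have h3 : HasMFDerivAt 𝓘(ℝ, 𝔼 × ℝ) 𝓘(ℝ, ℝ) (Prod.snd : 𝔼 × ℝ → ℝ) (y, r)
      (ContinuousLinearMap.snd ℝ 𝔼 ℝ) := hasFDerivAt_snd.hasMFDerivAt
  have h4 := (HasMFDerivAt.comp (y, r) h1 h2).prodMk h3
  have h5 : ((extChartAt 𝓡t (p, t)).symm : 𝔼 × ℝ → M × ℝ)
      = fun y => (((extChartAt (𝓡 n) p).symm ∘ Prod.fst) y, y.2) :=
    funext fun y => extChartAt_spaceTime_symm_apply p t y
  rw [fromChart, ModelWithCorners.range_eq_univ, mfderivWithin_univ]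
  rw [← h5] at h4
  exact DFunLike.congr_fun h4.mfderiv v

theorem toChart_spaceTime {q : M} (hq : q ∈ (extChartAt (𝓡 n) p).source) (t r : ℝ)
    (v : 𝔼 × ℝ) :
    (toChart 𝓡t (p, t) (q, r) v : 𝔼 × ℝ) = (toChart (𝓡 n) p q v.1, v.2) := by
  have : IsManifold (𝓡 n) 1 M := IsManifold.of_le (n := ∞) (by simp)
  have h1 : HasMFDerivAt (𝓡 n) 𝓘(ℝ, 𝔼) (extChartAt (𝓡 n) p) q (toChart (𝓡 n) p q) :=
    (mdifferentiableAt_extChartAt (by simpa using hq)).hasMFDerivAt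
  have h2 : HasMFDerivAt 𝓡t (𝓡 n) (Prod.fst : M × ℝ → M) (q, r) _ := hasMFDerivAt_fst _
  have h3 : HasMFDerivAt 𝓡t 𝓘(ℝ, ℝ) (Prod.snd : M × ℝ → ℝ) (q, r) _ := hasMFDerivAt_snd _
  have h4 := HasMFDerivAt.comp (q, r) h1 h2
  have h4' : HasMFDerivAt 𝓡t 𝓘(ℝ, 𝔼 × ℝ)
      (fun y : M × ℝ => ((extChartAt (𝓡 n) p ∘ Prod.fst) y, y.2)) (q, r) _ :=
    ⟨h4.1.prodMk h3.1, h4.2.prodMk h3.2⟩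
  have h5 : (extChartAt 𝓡t (p, t) : M × ℝ → 𝔼 × ℝ)
      = fun y => ((extChartAt (𝓡 n) p ∘ Prod.fst) y, y.2) :=
    funext fun y => extChartAt_spaceTime_apply p y.1 t y.2
  rw [← h5] at h4'
  exact DFunLike.congr_fun h4'.mfderiv v

theorem gHat_apply (g : MetricFamily n M) (q : M × ℝ) (v w : 𝔼 × ℝ) :
    gHat g q v w = (g q.2).inner q.1 v.1 w.1 + v.2 * w.2 := by
  rfl

theorem coordMetric_gHat (g : MetricFamily n M) (p : M) (t : ℝ) :
    EqOn (coordMetric 𝓡t (gHat g) (p, t))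
      (stMetric fun t => coordMetric (𝓡 n) (g t).inner p)
      ((extChartAt (𝓡 n) p).target ×ˢ Icc 0 T) := by
  rintro ⟨y, r⟩ hy
  refine ContinuousLinearMap.ext fun v => ContinuousLinearMap.ext fun w => ?_
  refine (gHat_apply g ((extChartAt 𝓡t (p, t)).symm (y, r)) (fromChart 𝓡t (p, t) (y, r) v)
    (fromChart 𝓡t (p, t) (y, r) w)).trans ?_
  rw [fromChart_spaceTime hy.1, fromChart_spaceTime hy.1]
  rfl

theorem gHat_eq_stMetric (g : MetricFamily n M) (p : M) (t : ℝ) (v w : 𝔼 × ℝ) :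
    gHat g (p, t) v w
      = stMetric (fun t => coordMetric (𝓡 n) (g t).inner p) (extChartAt (𝓡 n) p p, t) v w := by
  have : IsManifold (𝓡 n) 1 M := IsManifold.of_le (n := ∞) (by simp)
  rw [gHat_apply, stMetric_apply]
  congr 1
  have h := coordMetric_toChart (I := 𝓡 n) (g t).inner (mem_extChartAt_source p) v.1 w.1
  have hid : ∀ a : 𝔼, (toChart (𝓡 n) p p a : 𝔼) = a := toChart_self p
  exact (h.symm.trans (by rw [hid, hid]))

/-- The only use of the evolution equation of the metric. Coordinate vectors do not depend on time,
so it can be compared with the time derivative of the coefficients. It is needed throughout the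
chart, not only at the centre, because ∇Ric differentiates in space. -/
theorem Ric_fromChart (hT : 0 < T) (hg : IsRicciFlow g T) (ht : t ∈ Icc 0 T) {y : 𝔼}
    (hy : y ∈ (extChartAt (𝓡 n) p).target) (v w : 𝔼) :
    Ric g t ((extChartAt (𝓡 n) p).symm y) (fromChart (𝓡 n) p y v) (fromChart (𝓡 n) p y w)
      = halfNegTimeDeriv (fun t => coordMetric (𝓡 n) (g t).inner p) (extChartAt (𝓡 n) p).target
          (Icc 0 T) (y, t) v w := by
  have hmet := isMetricFamilyOn_coordMetric hT hg p
  have h1 := hg.evolution t ht ((extChartAt (𝓡 n) p).symm y) (fromChart (𝓡 n) p y v)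
    (fromChart (𝓡 n) p y w)
  have h2 : HasDerivWithinAt (fun t' : ℝ => (y, t')) ((0 : 𝔼), (1 : ℝ)) (Icc 0 T) t :=
    (hasDerivWithinAt_const t _ y).prodMk (hasDerivWithinAt_id t _)
  have h3 := HasFDerivWithinAt.comp_hasDerivWithinAt
    (t := (extChartAt (𝓡 n) p).target ×ˢ Icc 0 T) t
    (hmet.differentiableOn (y, t) ⟨hy, ht⟩).hasFDerivWithinAt h2 fun t' ht' => ⟨hy, ht'⟩
  have h4 := (h3.clm_apply (hasDerivWithinAt_const t _ v)).clm_apply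
    (hasDerivWithinAt_const t _ w)
  have h5 := ((uniqueDiffOn_Icc hT) t ht).eq_deriv _ h1 h4
  simp only [map_zero, add_zero] at h5
  simp only [halfNegTimeDeriv, smul_apply, smul_eq_mul]
  linarith

theorem fromChart_self (p : M) (v : 𝔼) :
    (fromChart (𝓡 n) p (extChartAt (𝓡 n) p p) v : 𝔼) = v := by
  have : IsManifold (𝓡 n) 1 M := IsManifold.of_le (n := ∞) (by simp)
  exact DFunLike.congr_fun (mfderivWithin_range_extChartAt_symm (I := 𝓡 n) (x := p)) v

theorem Ric_eq (hT : 0 < T) (hg : IsRicciFlow g T) (ht : t ∈ Icc 0 T) (p : M) (v w : 𝔼) :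
    Ric g t p v w
      = halfNegTimeDeriv (fun t => coordMetric (𝓡 n) (g t).inner p) (extChartAt (𝓡 n) p).target
          (Icc 0 T) (extChartAt (𝓡 n) p p, t) v w := by
  rw [← Ric_fromChart hT hg ht (mem_extChartAt_target p), fromChart_self, fromChart_self,
    extChartAt_to_inv]

theorem covDerivRic_eq (hT : 0 < T) (hg : IsRicciFlow g T) (ht : t ∈ Icc 0 T) (p : M)
    (a v w : 𝔼) :
    covDerivRic g t p a v w
      = fderivWithin ℝ (fun y => halfNegTimeDeriv (fun t => coordMetric (𝓡 n) (g t).inner p)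
            (extChartAt (𝓡 n) p).target (Icc 0 T) (y, t) v w)
          (extChartAt (𝓡 n) p).target (extChartAt (𝓡 n) p p) a
        - halfNegTimeDeriv (fun t => coordMetric (𝓡 n) (g t).inner p) (extChartAt (𝓡 n) p).target
          (Icc 0 T) (extChartAt (𝓡 n) p p, t)
          (christoffel (coordMetric (𝓡 n) (g t).inner p) (extChartAt (𝓡 n) p).target
            (extChartAt (𝓡 n) p p) a v) w
        - halfNegTimeDeriv (fun t => coordMetric (𝓡 n) (g t).inner p) (extChartAt (𝓡 n) p).target
          (Icc 0 T) (extChartAt (𝓡 n) p p, t) v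
          (christoffel (coordMetric (𝓡 n) (g t).inner p) (extChartAt (𝓡 n) p).target
            (extChartAt (𝓡 n) p p) a w) := by
  rw [← Ric_eq hT hg ht, ← Ric_eq hT hg ht]
  simp only [covDerivRic, covDerivTensor, christoffelAt, chartRegion_univ]
  congr 3
  exact fderivWithin_congr (fun y hy => Ric_fromChart hT hg ht hy v w)
    (Ric_fromChart hT hg ht (mem_extChartAt_target p) v w)

theorem rmHat_eq (g : MetricFamily n M) (ht : t ∈ Icc 0 T) (p : M) (a b v w : 𝔼 × ℝ) :
    rmHat g T (p, t) a b v w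
      = stMetric (fun t => coordMetric (𝓡 n) (g t).inner p) (extChartAt (𝓡 n) p p, t)
          (curvature (stMetric fun t => coordMetric (𝓡 n) (g t).inner p)
            ((extChartAt (𝓡 n) p).target ×ˢ Icc 0 T) (extChartAt (𝓡 n) p p, t) b w a) v := by
  have h : (curvatureOp 𝓡t (gHat g) (spaceTime M T) (p, t) b w a : 𝔼 × ℝ)
      = curvature (stMetric fun t => coordMetric (𝓡 n) (g t).inner p)
            ((extChartAt (𝓡 n) p).target ×ˢ Icc 0 T) (extChartAt (𝓡 n) p p, t) b w a := by
    change curvature (coordMetric 𝓡t (gHat g) (p, t)) (chartRegion 𝓡t (spaceTime M T) (p, t))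
      (extChartAt 𝓡t (p, t) (p, t)) b w a = _
    rw [chartRegion_spaceTime, extChartAt_spaceTime_apply,
      curvature_congr (coordMetric_gHat g p t) ⟨mem_extChartAt_target p, ht⟩]
  rw [← h]
  exact gHat_eq_stMetric g p t _ v

theorem christoffelAt_gHat (g : MetricFamily n M) (ht : t ∈ Icc 0 T) (p : M) :
    christoffelAt 𝓡t (gHat g) (spaceTime M T) (p, t)
      = christoffel (stMetric fun t => coordMetric (𝓡 n) (g t).inner p)
          ((extChartAt (𝓡 n) p).target ×ˢ Icc 0 T) (extChartAt (𝓡 n) p p, t) := by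
  rw [christoffelAt, chartRegion_spaceTime, extChartAt_spaceTime_apply]
  exact christoffel_congr (coordMetric_gHat g p t) ⟨mem_extChartAt_target p, ht⟩

theorem velocity_cHat (hc : IsCurveShrinkingFlow g T c) (ht : t ∈ Icc 0 T) (x : ℝ) :
    (velocity 𝓡t (cHat c t) x : 𝔼 × ℝ) = (tangentX c x t, 0) := by
  have h1 := (hc.mdifferentiableAt_curveAt (x := x) ht).hasMFDerivAt
  have h2 : HasMFDerivAt 𝓘(ℝ, ℝ) 𝓘(ℝ, ℝ) (fun _ : ℝ => t) x 0 := hasMFDerivAt_const t x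
  exact DFunLike.congr_fun (h1.prodMk h2).mfderiv (1 : ℝ)

theorem hHat_eq (hT : 0 < T) (hc : IsCurveShrinkingFlow g T c) (ht : t ∈ Icc 0 T) (x : ℝ) :
    (hHat T c x t : 𝔼 × ℝ) = (vecH g c x t, 1) := by
  have h1 := (hc.mdifferentiableWithinAt_t ht x).hasMFDerivWithinAt
  have h2 : HasMFDerivWithinAt 𝓘(ℝ, ℝ) 𝓘(ℝ, ℝ) (fun t' : ℝ => t') (Icc 0 T) t
      (ContinuousLinearMap.id ℝ ℝ) := (hasFDerivWithinAt_id t _).hasMFDerivWithinAt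
  have h3 := (h1.prodMk h2).mfderivWithin (uniqueDiffOn_Icc hT t ht).uniqueMDiffWithinAt
  rw [← hc.evolution x t ht]
  exact DFunLike.congr_fun h3 (1 : ℝ)

end Product

/-! ### Matching the geometric quantities with the coordinate ones. -/

section Identification

variable {n : ℕ} {M : Type*} [TopologicalSpace M] [ChartedSpace (EuclideanSpace ℝ (Fin n)) M]
  [IsManifold (𝓡 n) ∞ M] {g : MetricFamily n M} {T : ℝ} {c : Circle → ℝ → M} {p : M} {O A : Set ℝ}

local notation "𝔼" => EuclideanSpace ℝ (Fin n)
local notation "𝓡t" => ModelWithCorners.prod (𝓡 n) 𝓘(ℝ, ℝ)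

theorem curvSq_chart {z : ℝ × ℝ} (hz : curveAt c z.2 z.1 ∈ (extChartAt (𝓡 n) p).source) :
    IsCoordFlow.curvSq (fun t => coordMetric (𝓡 n) (g t).inner p) (flowChart (n := n) p c)
      (vecHChart p g c) z = kSq g c z.1 z.2 := by
  have : IsManifold (𝓡 n) 1 M := IsManifold.of_le (n := ∞) (by simp)
  rw [IsCoordFlow.curvSq, stMetric_apply]
  simp only [hor, mul_zero, add_zero]
  exact coordMetric_toChart _ hz _ _

theorem unitSChart_self (g : MetricFamily n M) (c : Circle → ℝ → M) (x t : ℝ) :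
    unitSChart (curveAt c t x) g c (x, t) = unitS g c x t := by
  have : IsManifold (𝓡 n) 1 M := IsManifold.of_le (n := ∞) (by simp)
  exact toChart_self _ _

theorem vecHChart_self (g : MetricFamily n M) (c : Circle → ℝ → M) (x t : ℝ) :
    vecHChart (curveAt c t x) g c (x, t) = vecH g c x t := by
  have : IsManifold (𝓡 n) 1 M := IsManifold.of_le (n := ∞) (by simp)
  exact toChart_self _ _

/-- The arc length derivative in terms of a function on a region of the `(x,t)`-plane. -/
theorem arcDeriv_eq {x t : ℝ} {K : Set ℝ} (hO : IsOpen O) (hx : x ∈ O) (ht : t ∈ K)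
    {f : ℝ → ℝ} {φ : ℝ × ℝ → ℝ} (hφ : DifferentiableWithinAt ℝ φ (O ×ˢ K) (x, t))
    (hf : ∀ x' ∈ O, f x' = φ (x', t)) :
    arcDeriv g c t f x = (speed g c x t)⁻¹ * fderivWithin ℝ φ (O ×ˢ K) (x, t) (1, 0) := by
  rw [arcDeriv, ← (hasDerivAt_slice hO hx ht hφ).deriv]
  congr 1
  refine Filter.EventuallyEq.deriv_eq ?_
  filter_upwards [hO.mem_nhds hx] with x' hx' using hf x' hx'

/-- The chart is centred at the point in question, so `covDerivAlong` unfolds directly and no change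
of chart is needed. -/
theorem nablaSH_eq {x t : ℝ} (hc : IsCurveShrinkingFlow g T c) (hO : IsOpen O) (hx : x ∈ O)
    (ht : t ∈ Icc 0 T ∩ A)
    (hsrc : ∀ z ∈ O ×ˢ (Icc 0 T ∩ A),
      curveAt c z.2 z.1 ∈ (extChartAt (𝓡 n) (curveAt c t x)).source)
    (h : IsCoordFlow (fun t' => coordMetric (𝓡 n) (g t').inner (curveAt c t x))
      (extChartAt (𝓡 n) (curveAt c t x)).target (Icc 0 T)
      (O ×ˢ (Icc 0 T ∩ A)) (flowChart (n := n) (curveAt c t x) c) (fun z => speed g c z.1 z.2)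
      (unitSChart (curveAt c t x) g c) (vecHChart (curveAt c t x) g c)) :
    (nablaSH g T c x t : 𝔼 × ℝ)
      = IsCoordFlow.nablaH (fun t' => coordMetric (𝓡 n) (g t').inner (curveAt c t x))
          (extChartAt (𝓡 n) (curveAt c t x)).target (Icc 0 T) (O ×ˢ (Icc 0 T ∩ A))
          (flowChart (n := n) (curveAt c t x) c) (fun z => speed g c z.1 z.2)
          (vecHChart (curveAt c t x) g c) (x, t) := by
  have : IsManifold (𝓡 n) 1 M := IsManifold.of_le (n := ∞) (by simp)
  have hz : (x, t) ∈ O ×ˢ (Icc 0 T ∩ A) := ⟨hx, ht⟩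
  have hd : deriv (fun x' => (toChart 𝓡t (cHat c t x) (cHat c t x') (hHor g c x' t) : 𝔼 × ℝ)) x
      = fderivWithin ℝ (hor (vecHChart (curveAt c t x) g c)) (O ×ˢ (Icc 0 T ∩ A)) (x, t)
          (1, 0) := by
    have h1 := hasDerivAt_slice hO hx ht
      ((IsCoordFlow.contDiffOn_hor h.smooth_H).differentiableOn (by simp) (x, t) hz)
    rw [← h1.deriv]
    refine Filter.EventuallyEq.deriv_eq ?_
    filter_upwards [hO.mem_nhds hx] with x' hx'
    exact toChart_spaceTime (hsrc (x', t) ⟨hx', ht⟩) t t _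
  have hΓ := christoffelAt_gHat (n := n) g ht.1 (curveAt c t x)
  have hv : (velocity 𝓡t (cHat c t) x : 𝔼 × ℝ)
      = fderivWithin ℝ (liftST (flowChart (n := n) (curveAt c t x) c)) (O ×ˢ (Icc 0 T ∩ A))
          (x, t) (1, 0) := by
    rw [velocity_cHat hc ht.1, h.fderivWithin_liftST hz, hc.flowChart_x hO hsrc hz]
    congr 1
    exact (toChart_self (I := 𝓡 n) (curveAt c t x) (tangentX c x t)).symm
  have hH : (hHor g c x t : 𝔼 × ℝ) = hor (vecHChart (curveAt c t x) g c) (x, t) := by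
    rw [hor, vecHChart_self]
    rfl
  have key : (covDerivAlong 𝓡t (gHat g) (spaceTime M T) (cHat c t) (fun x' => hHor g c x' t) x
      : 𝔼 × ℝ) = deriv (fun x' =>
        (toChart 𝓡t (cHat c t x) (cHat c t x') (hHor g c x' t) : 𝔼 × ℝ)) x
      + (christoffelAt 𝓡t (gHat g) (spaceTime M T) (curveAt c t x, t) :
        𝔼 × ℝ →L[ℝ] 𝔼 × ℝ →L[ℝ] 𝔼 × ℝ) (velocity 𝓡t (cHat c t) x : 𝔼 × ℝ)
        (hHor g c x t : 𝔼 × ℝ) := rfl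
  rw [hd, hΓ, hv, hH] at key
  exact congrArg (fun a : 𝔼 × ℝ => (speed g c x t)⁻¹ • a) key

end Identification

/-- The square of the component of `N` orthogonal to a multiple `X` of a unit vector `S`. -/
theorem metric_perp_perp {F : Type*} [NormedAddCommGroup F] [NormedSpace ℝ F]
    (B : F →L[ℝ] F →L[ℝ] ℝ) {N S X : F} {σ k : ℝ} (hX : X = σ • S) (hσ : σ ≠ 0)
    (hB : B S N = B N S) (hS : B S S = 1) (hN : B N S = -k) :
    B (N - (B N X / B X X) • X) (N - (B N X / B X X) • X) = B N N - k ^ 2 := by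
  subst hX
  simp only [map_sub, map_smul, sub_apply, smul_apply, smul_eq_mul, hB, hS, hN]
  field_simp
  ring

end RicciCurveFlow

end

/-! ### The evolution equation on the manifold. -/

open RicciCurveFlow
theorem mainTheorem1 {n : ℕ} {M : Type*} [TopologicalSpace M]
    [ChartedSpace (EuclideanSpace ℝ (Fin n)) M] [IsManifold (𝓡 n) ∞ M]
    [T2Space M] [CompactSpace M]
    (T : ℝ) (hT : 0 < T)
    (g : MetricFamily n M) (hg : IsRicciFlow g T)
    (c : Circle → ℝ → M) (hc : IsCurveShrinkingFlow g T c)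
    (x t : ℝ) (ht : t ∈ Icc 0 T) :
    HasDerivWithinAt (fun s => kSq g c x s)
      (arcDeriv g c t (arcDeriv g c t (fun x' => kSq g c x' t)) x
        - 2 * gHat g (cHat c t x) (nablaSHPerp g T c x t) (nablaSHPerp g T c x t)
        + 2 * (kSq g c x t) ^ 2
        - 2 * Ric g t (curveAt c t x) (vecH g c x t) (vecH g c x t)
        + 4 * kSq g c x t * Ric g t (curveAt c t x) (unitS g c x t) (unitS g c x t)
        + 2 * rmHat g T (cHat c t x) (hHat T c x t) (sHor g c x t) (hHor g c x t) (sHor g c x t)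
        + 2 * Ric g t (curveAt c t x) (unitS g c x t) (unitS g c x t)
            * Ric g t (curveAt c t x) (vecH g c x t) (vecH g c x t)
        - 2 * covDerivRic g t (curveAt c t x)
            (unitS g c x t) (unitS g c x t) (vecH g c x t))
      (Icc 0 T) t := by
  have : IsManifold (𝓡 n) 1 M := IsManifold.of_le (n := ∞) (by simp)
  obtain ⟨O, A, hO, hA, hx, htA, hsrc⟩ := hc.exists_nhds (x := x) ht
  have h := isCoordFlow_chart hT hg hc hO hA hsrc
  set p := curveAt c t x with hp
  set G : ℝ → EuclideanSpace ℝ (Fin n) →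
    EuclideanSpace ℝ (Fin n) →L[ℝ] EuclideanSpace ℝ (Fin n) →L[ℝ] ℝ :=
    fun t' => coordMetric (𝓡 n) (g t').inner p with hG
  have hz : (x, t) ∈ O ×ˢ (Icc 0 T ∩ A) := ⟨hx, ht, htA⟩
  have hHsm := IsCoordFlow.contDiffOn_hor h.smooth_H
  have hk := h.contDiffOn_metric hHsm hHsm
  have hkd := hk.differentiableOn (by simp)
  have hev := h.fderivWithin_curvSq_t hz
  have hderiv : HasDerivWithinAt (fun s => kSq g c x s)
      (fderivWithin ℝ (IsCoordFlow.curvSq G (flowChart (n := n) p c) (vecHChart p g c))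
        (O ×ˢ (Icc 0 T ∩ A)) (x, t) (0, 1)) (Icc 0 T) t := by
    have h1 := (hasDerivWithinAt_slice hx (hkd (x, t) hz)).congr
      (fun t' ht' => (curvSq_chart (g := g) (hsrc (x, t') ⟨hx, ht'⟩)).symm)
      (curvSq_chart (g := g) (hsrc (x, t) hz)).symm
    -- Shrinking the time interval by a neighbourhood of `t` does not affect the derivative.
    exact (hasDerivWithinAt_inter (hA.mem_nhds htA)).1 h1
  -- The formula for the first derivative holds for every nearby x', so it can be differentiated
  -- once more.
  have harc1 : ∀ x' ∈ O, arcDeriv g c t (fun x' => kSq g c x' t) x'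
      = (speed g c x' t)⁻¹ *
        fderivWithin ℝ (IsCoordFlow.curvSq G (flowChart (n := n) p c) (vecHChart p g c))
          (O ×ˢ (Icc 0 T ∩ A)) (x', t) (1, 0) := fun x' hx' =>
    arcDeriv_eq hO hx' (K := Icc 0 T ∩ A) ⟨ht, htA⟩ (hkd (x', t) ⟨hx', ht, htA⟩)
      fun x'' hx'' => (curvSq_chart (g := g) (hsrc (x'', t) ⟨hx'', ht, htA⟩)).symm
  have harc2 := arcDeriv_eq (g := g) (c := c) hO hx (K := Icc 0 T ∩ A) ⟨ht, htA⟩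
    ((h.contDiffOn_inv_σ.mul ((hk.fderivWithin h.uniqueDiffOn (m := ∞) (by simp)).clm_apply
      (contDiffOn_const (c := ((1 : ℝ), (0 : ℝ)))))).differentiableOn (by simp) (x, t) hz) harc1
  have hS : unitSChart p g c (x, t) = unitS g c x t := unitSChart_self g c x t
  have hH : vecHChart p g c (x, t) = vecH g c x t := vecHChart_self g c x t
  have hRicS : Ric g t p (unitS g c x t) (unitS g c x t)
      = IsCoordFlow.tensorAlong G (extChartAt (𝓡 n) p).target (Icc 0 T) (flowChart (n := n) p c)
        (unitSChart p g c) (unitSChart p g c) (x, t) := by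
    rw [IsCoordFlow.tensorAlong, hS]
    exact Ric_eq hT hg ht p _ _
  have hRicH : Ric g t p (vecH g c x t) (vecH g c x t)
      = IsCoordFlow.tensorAlong G (extChartAt (𝓡 n) p).target (Icc 0 T) (flowChart (n := n) p c)
        (vecHChart p g c) (vecHChart p g c) (x, t) := by
    rw [IsCoordFlow.tensorAlong, hH]
    exact Ric_eq hT hg ht p _ _
  have hcov : covDerivRic g t p (unitS g c x t) (unitS g c x t) (vecH g c x t)
      = IsCoordFlow.nablaTensor G (extChartAt (𝓡 n) p).target (Icc 0 T) (flowChart (n := n) p c)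
        (unitSChart p g c) (vecHChart p g c) (x, t) := by
    rw [IsCoordFlow.nablaTensor, hS, hH]
    exact covDerivRic_eq hT hg ht p _ _ _
  have hSz : (sHor g c x t : EuclideanSpace ℝ (Fin n) × ℝ) = hor (unitSChart p g c) (x, t) := by
    rw [hor, hS]
    rfl
  have hHz : (hHor g c x t : EuclideanSpace ℝ (Fin n) × ℝ) = hor (vecHChart p g c) (x, t) := by
    rw [hor, hH]
    rfl
  have hYz : (hHat T c x t : EuclideanSpace ℝ (Fin n) × ℝ)
      = fderivWithin ℝ (liftST (flowChart (n := n) p c)) (O ×ˢ (Icc 0 T ∩ A)) (x, t) (0, 1) := by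
    rw [hHat_eq hT hc ht, h.fderivWithin_liftST hz, h.evolution _ hz, hH]
    rfl
  have hRm : rmHat g T (cHat c t x) (hHat T c x t) (sHor g c x t) (hHor g c x t) (sHor g c x t)
      = stMetric G (liftST (flowChart (n := n) p c) (x, t))
        (curvature (stMetric G) ((extChartAt (𝓡 n) p).target ×ˢ Icc 0 T)
          (liftST (flowChart (n := n) p c) (x, t)) (hor (unitSChart p g c) (x, t))
          (hor (unitSChart p g c) (x, t))
          (fderivWithin ℝ (liftST (flowChart (n := n) p c)) (O ×ˢ (Icc 0 T ∩ A)) (x, t) (0, 1)))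
        (hor (vecHChart p g c) (x, t)) := by
    rw [← hSz, ← hHz, ← hYz]
    exact rmHat_eq g ht p _ _ _ _
  have hN := nablaSH_eq hc hO hx ⟨ht, htA⟩ hsrc h
  have hX : (xHor c x t : EuclideanSpace ℝ (Fin n) × ℝ)
      = speed g c x t • hor (unitSChart p g c) (x, t) := by
    have h1 := (hc.flowChart_x hO hsrc hz).symm.trans (h.deriv_x _ hz)
    have h2 : (tangentX c x t : EuclideanSpace ℝ (Fin n))
        = speed g c x t • unitSChart p g c (x, t) :=
      (toChart_self (I := 𝓡 n) p (tangentX c x t)).symm.trans h1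
    refine Prod.ext h2 ?_
    simp [hor, xHor, stVec]
  have hperp : gHat g (cHat c t x) (nablaSHPerp g T c x t) (nablaSHPerp g T c x t)
      = stMetric G (liftST (flowChart (n := n) p c) (x, t))
          (IsCoordFlow.nablaH G (extChartAt (𝓡 n) p).target (Icc 0 T) (O ×ˢ (Icc 0 T ∩ A))
            (flowChart (n := n) p c) (fun z => speed g c z.1 z.2) (vecHChart p g c) (x, t))
          (IsCoordFlow.nablaH G (extChartAt (𝓡 n) p).target (Icc 0 T) (O ×ˢ (Icc 0 T ∩ A))
            (flowChart (n := n) p c) (fun z => speed g c z.1 z.2) (vecHChart p g c) (x, t))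
        - IsCoordFlow.curvSq G (flowChart (n := n) p c) (vecHChart p g c) (x, t) ^ 2 := by
    have hσ := (h.σ_pos _ hz).ne'
    have hB : ∀ v w : EuclideanSpace ℝ (Fin n) × ℝ, gHat g (cHat c t x) v w
        = stMetric G (liftST (flowChart (n := n) p c) (x, t)) v w := gHat_eq_stMetric g p t
    have hNS' := (hB _ _).trans
      (congrArg (fun v => stMetric G _ v (hor (unitSChart p g c) (x, t))) hN)
    -- The removed component is that of ⟨∇_S H, S⟩ = -k², hence has square k⁴; this accounts for the
    -- change of coefficient from 4k⁴ to 2k⁴.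
    have key := metric_perp_perp (F := EuclideanSpace ℝ (Fin n) × ℝ) (gHat g (cHat c t x))
      (N := nablaSH g T c x t) (X := xHor c x t)
      (k := IsCoordFlow.curvSq G (flowChart (n := n) p c) (vecHChart p g c) (x, t)) hX hσ
      ((hB _ _).trans ((h.metric_comm hz _ _).trans (hB _ _).symm))
      ((hB _ _).trans (h.metric_S_S hz))
      (hNS'.trans (h.metric_nablaH_S hz))
    exact key.trans (congrArg (· - _) ((hB _ _).trans
      (congrArg (fun v => stMetric G _ v v) hN)))
  refine hderiv.congr_deriv ?_
  rw [hev, harc2, hperp, hRicS, hRicH, hcov, hRm, ← curvSq_chart (hsrc (x, t) hz)]
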